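/- Fix integers $L\ge 0$ and $L_1,\dots,L_L\ge 0$, and consider networks between Euclidean spaces $$f=\sigma_L\circ f_L\circ\dots\circ\sigma_1\circ f_1:\mathbb R^d\to\mathbb R^\kappa,\qquad f_i=g_i+\sigma_{iL_i}\circ h_{iL_i}\circ\dots\circ\sigma_{i1}\circ h_{i1},$$ with $\kappa\ge 2$. The nonlinearities $\sigma_i$, $\sigma_{ij}$ are fixed, $\rho_i$- resp. $\rho_{ij}$-Lipschitz, and map $0$ to $0$; the shortcuts $g_i$ are fixed Lipschitz maps with $g_i(0)=0$. All Lipschitz constants are with respect to Euclidean norms, and $\operatorname{Lip}(g)$ is the least Lipschitz constant of $g$. For every layer $(i,j)$, $1\le i\le L$, $1\le j\le L_i$, let $s_{ij}>0$, $b_{ij}>0$ and a reference weight $M_{ij}$ be fixed. Each layer is of one of the following two kinds, which is fixed in advance: * fully-connected: $h_{ij}(x)=A_{ij}x$ for a matrix $A_{ij}$ with $\operatorname{Lip}(h_{ij})\le s_{ij}$ and $\|A_{ij}^\top-M_{ij}^\top\|_{2,1}\le b_{ij}$, where $\|B\|_{2,1}$ is the sum of the $\ell_2$ norms of the columns of $B$;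 * convolutional: $h_{ij}=\phi_{K_{ij}}$ is the (zero-padded, strided, bias-free) 2D multi-channel convolution with a weight tensor $K_{ij}\in\mathbb R^{c_{\rm out}\times c_{\rm in}\times k_h\times k_w}$ such that $\operatorname{Lip}(\phi_{K_{ij}})\le s_{ij}$ and $\|K_{ij}-M_{ij}\|_{2,1}\le b_{ij}$, where $\|K\|_{2,1}=\sum_{p,k,l}\big(\sum_r K_{prkl}^2\big)^{1/2}$ ($p$: output channel, $r$: input channel). Let $\mathcal F$ be the class of all such networks $f$. Let $W_{ij}$ be the number of parameters of layer $(i,j)$ (the number of entries of $A_{ij}$, resp. $K_{ij}$), $W=\max_{ij}W_{ij}$, $\bar L=\sum_i L_i$, and $s_i=\operatorname{Lip}(g_i)+\prod_{j=1}^{L_i}\rho_{ij}s_{ij}$. Let $n\ge 1$, let $S=((x_1,y_1),\dots,(x_n,y_n))$ with $x_k\in\mathbb R^d$, $y_k\in\{1,\dots,\kappa\}$, let $\|X\|=(\sum_k\|x_k\|_2^2)^{1/2}$, let $\gamma>0$, and set $$C_{ij}=2\,\frac{\|X\|}{\sqrt n}\Big(\prod_{l=1}^{L}s_l\rho_l\Big)\frac{\prod_{k=1}^{L_i}s_{ik}\rho_{ik}}{s_i}\,\frac{b_{ij}}{s_{ij}},\qquad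 \tilde C_{ij}=\frac{2C_{ij}}{\gamma},$$ with the convention $0/0=0$ if $s_i=0$. Let $\mathcal F_\gamma=\{(x,y)\mapsto \ell_\gamma(-\mathcal M(f(x),y)) : f\in\mathcal F\}$ with the margin $\mathcal M(v,y)=v_y-\max_{i\ne y}v_i$ and the ramp loss $\ell_\gamma(r)=(1+r/\gamma)\mathbf 1_{r\in[-\gamma,0]}+\mathbf 1_{r>0}$. The empirical Rademacher complexity is $\mathfrak R_S(\mathcal H)=\mathbb E_\sigma\big[\sup_{h\in\mathcal H}\frac1n\sum_{k=1}^n\sigma_k h(x_k,y_k)\big]$, with $\sigma$ uniform on $\{\pm1\}^n$. Let $H_{n-1}=\sum_{m=1}^{n-1}\frac1m$. Then $$\mathfrak R_S(\mathcal F_\gamma)\le\frac4n+\frac{12H_{n-1}}{\sqrt n}\sqrt{\log(2W)}\Big(\sum_{i=1}^{L}\sum_{j=1}^{L_i}\big\lceil\tilde C_{ij}^{2/3}\big\rceil\Big)^{3/2}\tag{$\clubsuit$}$$ (the second term is $0$ if there are no layers or all $W_{ij}=0$) and $$\mathfrak R_S(\mathcal F_\gamma)\le\frac{12}{\sqrt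 n}\sqrt{\sum_{i=1}^{L}\sum_{j=1}^{L_i}2W_{ij}\Big(\log\big(1+\lceil\bar L^2\tilde C_{ij}^2\rceil\big)+\psi\big(\lceil\bar L^2\tilde C_{ij}^2\rceil\big)\Big)},\tag{$\spadesuit$}$$ where $\psi:[0,\infty)\to\mathbb R$ is defined by $\psi(0)=0$ and $\psi(x)=\zeta(\tfrac32,1)^{1/3}\,\zeta(\tfrac32,1+\tfrac1x)^{2/3}$ for $x>0$, with $\zeta(t,q)=\sum_{k\ge0}(q+k)^{-t}$ the Hurwitz zeta function. The function $\psi$ is strictly increasing and $\psi(x)<2.7$ for all $x\ge0$. Moreover $H_{n-1}=\mathcal O(\log n)$. -/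

import Mathlib

open Finset
open scoped NNReal Matrix

noncomputable section

namespace ResNet

/-- `ℝ^d` with the Euclidean norm. -/
abbrev Vec (d : ℕ) : Type := EuclideanSpace ℝ (Fin d)

/-! ### Classification: margin, ramp loss, empirical Rademacher complexity -/

/-- The margin operator `(v, y) ↦ v_y - max_{i ≠ y} v_i` (used with at least two classes). -/
def margin {κ : ℕ} (v : Vec κ) (y : Fin κ) : ℝ :=
  v y - ⨆ i : {i : Fin κ // i ≠ y}, v i

/-- The ramp loss `r ↦ (1 + r/γ) 1_{r ∈ [-γ, 0]} + 1_{r > 0}`. -/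
def rampLoss (γ r : ℝ) : ℝ :=
  if 0 < r then 1 else if -γ ≤ r then 1 + r / γ else 0

/-- The class `F_γ` of the maps `(x, y) ↦ ℓ_γ(-M(f(x), y))`, for `f` in `F`. -/
def rampClass {d κ : ℕ} (γ : ℝ) (F : Set (Vec d → Vec κ)) : Set (Vec d × Fin κ → ℝ) :=
  {h | ∃ f ∈ F, h = fun z => rampLoss γ (-margin (f z.1) z.2)}

/-- The empirical Rademacher complexity of a class `H` of (uniformly bounded) real functions on the
sample `S`: the average over all `2 ^ n` sign vectors of `sup_h (1/n) ∑ σ_k h(z_k)`. -/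
def rademacher {Z : Type*} {n : ℕ} (S : Fin n → Z) (H : Set (Z → ℝ)) : ℝ :=
  (∑ σ : Fin n → ℤˣ,
    sSup ((fun h : Z → ℝ => (1 / (n : ℝ)) * ∑ k, ((σ k : ℤ) : ℝ) * h (S k)) '' H)) / 2 ^ n

/-- The norm `√(‖x_1‖² + ⋯ + ‖x_n‖²)` of the data. -/
def dataNorm {d n : ℕ} (x : Fin n → Vec d) : ℝ :=
  √(∑ k, ‖x k‖ ^ 2)

/-- The least Lipschitz constant of a Lipschitz map. -/
def lipConst {d m : ℕ} (f : Vec d → Vec m) : ℝ≥0 :=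
  sInf {K : ℝ≥0 | LipschitzWith K f}

/-! ### Layers -/

/-- The geometry of a multi-channel strided two-dimensional convolution `ℝ^d → ℝ^m` with zero
padding. `ein` and `eout` identify the coordinates with (channel, row, column).
Output pixel `(μ, ν)` reads, at kernel position `(a, b)`, the input pixel
`(strideH * μ + a - padH, strideW * ν + b - padW)`, or zero if this lies outside of the input
image (all indices start at zero). The input-size preserving padding for stride one is
`padH = ⌊kh / 2⌋`, `padW = ⌊kw / 2⌋`. -/
structure ConvGeometry (d m : ℕ) where
  cin : ℕ
  h : ℕ
  w : ℕ
  cout : ℕ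
  hOut : ℕ
  wOut : ℕ
  kh : ℕ
  kw : ℕ
  strideH : ℕ
  strideW : ℕ
  padH : ℕ
  padW : ℕ
  strideH_pos : 0 < strideH
  strideW_pos : 0 < strideW
  ein : Fin d ≃ Fin cin × Fin h × Fin w
  eout : Fin m ≃ Fin cout × Fin hOut × Fin wOut

namespace ConvGeometry

variable {d m : ℕ} (c : ConvGeometry d m)

/-- Weight tensors `K ∈ ℝ^(cout × cin × kh × kw)`. -/
abbrev Tensor : Type := Fin c.cout → Fin c.cin → Fin c.kh → Fin c.kw → ℝ

/-- The entry of channel `r` of the zero-padded image `x` that the output pixel `(μ, ν)` reads at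
kernel position `(a, b)`. -/
def pixel (x : Vec d) (r : Fin c.cin) (μ : Fin c.hOut) (ν : Fin c.wOut)
    (a : Fin c.kh) (b : Fin c.kw) : ℝ :=
  ∑ β : Fin c.h, ∑ δ : Fin c.w,
    if c.strideH * (μ : ℕ) + a = β + c.padH ∧ c.strideW * (ν : ℕ) + b = δ + c.padW then
      x (c.ein.symm (r, β, δ)) else 0

/-- The convolution `φ_K`. -/
def conv (K : c.Tensor) (x : Vec d) : Vec m :=
  WithLp.toLp 2 fun o =>
    ∑ r, ∑ a, ∑ b, K (c.eout o).1 r a b * c.pixel x r (c.eout o).2.1 (c.eout o).2.2 a b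

/-- The norm `‖K‖_{2,1} = ∑_{i k l} ‖K_{i · k l}‖_2`: the `l_2` norms are along input channels. -/
def tensorNorm (K : c.Tensor) : ℝ :=
  ∑ i, ∑ k, ∑ l, √(∑ j, K i j k l ^ 2)

end ConvGeometry

/-- The `(2,1)` group norm of a matrix: the sum of the `l_2` norms of its columns. -/
def matNorm {p q : ℕ} (B : Matrix (Fin p) (Fin q) ℝ) : ℝ :=
  ∑ j, √(∑ i, B i j ^ 2)

/-- The type of a layer `ℝ^d → ℝ^m`. -/
inductive Layer (d m : ℕ) : Type
  | full : Layer d m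
  | conv (c : ConvGeometry d m) : Layer d m

namespace Layer

variable {d m : ℕ}

/-- The weights of a layer: matrices, respectively tensors. -/
def Weight : Layer d m → Type
  | full => Matrix (Fin m) (Fin d) ℝ
  | conv c => c.Tensor

/-- The number of parameters of a layer. -/
def numParams : Layer d m → ℕ
  | full => m * d
  | conv c => c.cout * c.cin * c.kh * c.kw

/-- The map of a layer with given weights: `x ↦ A x`, respectively `φ_K`. -/
def apply : (ℓ : Layer d m) → ℓ.Weight → Vec d → Vec m
  | full, (A : Matrix (Fin m) (Fin d) ℝ) => fun x => WithLp.toLp 2 (A *ᵥ x.ofLp)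
  | conv c, (K : c.Tensor) => c.conv K

/-- The `(2,1)` group norm distance of two weights: `‖Aᵀ - Mᵀ‖_{2,1}`, respectively
`‖K - M‖_{2,1}`. -/
def weightDist : (ℓ : Layer d m) → ℓ.Weight → ℓ.Weight → ℝ
  | full, (A : Matrix (Fin m) (Fin d) ℝ), (M : Matrix (Fin m) (Fin d) ℝ) => matNorm (Aᵀ - Mᵀ)
  | conv c, (K : c.Tensor), (M : c.Tensor) => c.tensorNorm (K - M)

end Layer

/-! ### Residual networks -/

/-- The fixed data of a class of residual networks: blocks `i = 0, …, L - 1`, and in block `i` layers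
`j = 0, …, depth i - 1`. Layer `(i, j)` maps `ℝ^(dim i j)` to `ℝ^(pre i j)`, and is followed by the
nonlinearity `act i j` into `ℝ^(dim i (j + 1))`. Block `i` maps `ℝ^(dim i 0)` to
`ℝ^(dim i (depth i))`, and is followed by the nonlinearity `actOut i` into `ℝ^(dim (i + 1) 0)`. So
inputs are in `ℝ^(dim 0 0)`, outputs in `ℝ^(dim L 0)`. Entries with larger indices are never
used. -/
structure Architecture where
  /-- number of blocks -/
  L : ℕ
  /-- numbers `L_i` of layers -/
  depth : ℕ → ℕ
  dim : ℕ → ℕ → ℕ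
  pre : ℕ → ℕ → ℕ
  layer : ∀ i j, Layer (dim i j) (pre i j)
  /-- nonlinearities `σ_{ij}` -/
  act : ∀ i j, Vec (pre i j) → Vec (dim i (j + 1))
  /-- nonlinearities `σ_i` -/
  actOut : ∀ i, Vec (dim i (depth i)) → Vec (dim (i + 1) 0)
  /-- shortcuts `g_i` -/
  shortcut : ∀ i, Vec (dim i 0) → Vec (dim i (depth i))
  /-- reference weights `M_{ij}` -/
  ref : ∀ i j, (layer i j).Weight
  /-- Lipschitz constraints `s_{ij}` of the layers -/
  s : ℕ → ℕ → ℝ≥0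
  /-- distance constraints `b_{ij}` -/
  b : ℕ → ℕ → ℝ
  /-- Lipschitz constants `ρ_{ij}` of the `σ_{ij}` -/
  ρ : ℕ → ℕ → ℝ≥0
  /-- Lipschitz constants `ρ_i` of the `σ_i` -/
  ρOut : ℕ → ℝ≥0

namespace Architecture

variable (A : Architecture)

/-- The weights of a whole network. -/
abbrev Params : Type := ∀ i j, (A.layer i j).Weight

/-- The first `j` layers (with nonlinearities) of block `i`. -/
def inner (θ : A.Params) (i : ℕ) : (j : ℕ) → Vec (A.dim i 0) → Vec (A.dim i j)
  | 0 => fun x => x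
  | j + 1 => fun x => A.act i j ((A.layer i j).apply (θ i j) (inner θ i j x))

/-- The residual block `f_i = g_i + σ_{iL_i} ∘ h_{iL_i} ∘ ⋯ ∘ σ_{i1} ∘ h_{i1}`. -/
def block (θ : A.Params) (i : ℕ) (x : Vec (A.dim i 0)) : Vec (A.dim i (A.depth i)) :=
  A.shortcut i x + A.inner θ i (A.depth i) x

/-- The first `i` blocks of the network: `σ_i ∘ f_i ∘ ⋯ ∘ σ_1 ∘ f_1`. -/
def forward (θ : A.Params) : (i : ℕ) → Vec (A.dim 0 0) → Vec (A.dim i 0)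
  | 0 => fun x => x
  | i + 1 => fun x => A.actOut i (A.block θ i (forward θ i x))

/-- All layers satisfy their Lipschitz and distance constraints. -/
def Feasible (θ : A.Params) : Prop :=
  ∀ i < A.L, ∀ j < A.depth i,
    LipschitzWith (A.s i j) ((A.layer i j).apply (θ i j)) ∧
      (A.layer i j).weightDist (θ i j) (A.ref i j) ≤ A.b i j

/-- The class `F` of networks. -/
def netClass : Set (Vec (A.dim 0 0) → Vec (A.dim A.L 0)) :=
  {f | ∃ θ : A.Params, A.Feasible θ ∧ f = A.forward θ A.L}

/-- The standing assumptions: constraint strengths are positive, nonlinearities and shortcuts are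
Lipschitz and map zero to zero. -/
structure Valid : Prop where
  s_pos : ∀ i < A.L, ∀ j < A.depth i, 0 < A.s i j
  b_pos : ∀ i < A.L, ∀ j < A.depth i, 0 < A.b i j
  act_lip : ∀ i < A.L, ∀ j < A.depth i, LipschitzWith (A.ρ i j) (A.act i j)
  act_zero : ∀ i < A.L, ∀ j < A.depth i, A.act i j 0 = 0
  actOut_lip : ∀ i < A.L, LipschitzWith (A.ρOut i) (A.actOut i)
  actOut_zero : ∀ i < A.L, A.actOut i 0 = 0
  shortcut_lip : ∀ i < A.L, ∃ K : ℝ≥0, LipschitzWith K (A.shortcut i)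
  shortcut_zero : ∀ i < A.L, A.shortcut i 0 = 0

/-- The number `W_{ij}` of parameters of a layer. -/
def numParams (i j : ℕ) : ℕ := (A.layer i j).numParams

/-- `W = max_{ij} W_{ij}`. -/
def maxParams : ℕ :=
  (range A.L).sup fun i => (range (A.depth i)).sup fun j => A.numParams i j

/-- The total number of layers `∑ L_i`. -/
def totalLayers : ℕ := ∑ i ∈ range A.L, A.depth i

/-- `s_i = Lip(g_i) + ∏_j ρ_{ij} s_{ij}`. -/
def blockLip (i : ℕ) : ℝ :=
  lipConst (A.shortcut i) + ∏ j ∈ range (A.depth i), (A.ρ i j : ℝ) * A.s i j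

/-- The quantity `C_{ij}(X)`. -/
def C {n : ℕ} (x : Fin n → Vec (A.dim 0 0)) (i j : ℕ) : ℝ :=
  2 * (dataNorm x / √(n : ℝ)) * (∏ l ∈ range A.L, A.blockLip l * A.ρOut l) *
    ((∏ k ∈ range (A.depth i), (A.s i k : ℝ) * A.ρ i k) / A.blockLip i) *
    (A.b i j / A.s i j)

/-- `2 C_{ij}(X) / γ`. -/
def Ctilde {n : ℕ} (γ : ℝ) (x : Fin n → Vec (A.dim 0 0)) (i j : ℕ) : ℝ :=
  2 * A.C x i j / γ

end Architecture

/-! ### The function `ψ` -/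

/-- The Hurwitz zeta function `∑_{k ≥ 0} 1 / (q + k) ^ t`, for real `t > 1` and `q > 0`. -/
def hurwitz (t q : ℝ) : ℝ := ∑' k : ℕ, 1 / (q + k) ^ t

/-- `ψ(x) = ζ(3/2, 1)^(1/3) ζ(3/2, 1 + 1/x)^(2/3)` for `x > 0`, and `ψ(0) = 0`. -/
def psi (x : ℝ) : ℝ :=
  if 0 < x then
    hurwitz (3 / 2) 1 ^ (1 / 3 : ℝ) * hurwitz (3 / 2) (1 + 1 / x) ^ (2 / 3 : ℝ)
  else 0

end ResNet

end

namespace ResNet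

/-! The Rademacher complexity is controlled by chaining through dyadic covers of the loss vectors,
at radii `√n * 2^(-l)`, so everything rests on covering numbers of the networks evaluated on the
sample.

A single layer is covered by sparsification. On fixed data `X`, the layer output minus the output of
the reference weight is linear in the weight difference, hence a combination of `W` fixed vectors.
Cauchy-Schwarz inside each group of the (2,1) norm bounds the weighted ℓ1 mass of this combination
by `b * ‖X‖` (`matrix_decomposition`, `ConvGeometry.decomposition`). Maurey's argument
(`exists_sum_approx`) then replaces it by an average of `k` signed generators with error `b * ‖X‖ /
√k`. Such averages number at most `(2W)^k` when counted as sequences and at most `(k+1)^(2W)` when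
counted by multiplicities; these two counts are the source of the two bounds.

The covers are moved inside the feasible set, which doubles the radius but keeps all Lipschitz
constraints. They can therefore be composed layer by layer and block by block (`HasCover.comp`), the
error of a layer being multiplied by the Lipschitz constants of all other stages. With the factor
`2/γ` from margin and ramp loss, level `l` needs `∑ t_ij / √k_ij ≤ 2^(-l)`, where `t_ij` is
`Ctilde`.

For the first bound, minimising `∑ k_ij` under this constraint suggests `k_ij` proportional to
`t_ij^(2/3)`; every dyadic level then costs the same, and about `log₂ n` levels are summed. For the
second, each layer gets an equal share of the radius, the cost grows only linearly in `l`, and the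
chain is infinite. There `psi` enters only through its lower bound `1/2` on `[1, ∞)`, which absorbs
an additive constant. -/

/-! ### Sign sums, Massart's lemma and dyadic chaining. -/

/-- The pairing `∑ σ_k v_k` of a sign vector with a vector. -/
def signSum {n : ℕ} (σ : Fin n → ℤˣ) (v : Vec n) : ℝ :=
  ∑ k, ((σ k : ℤ) : ℝ) * v k

theorem signSum_sub {n : ℕ} (σ : Fin n → ℤˣ) (v w : Vec n) :
    signSum σ (v - w) = signSum σ v - signSum σ w := by
  simp [signSum, mul_sub, sum_sub_distrib]

theorem signSum_le {n : ℕ} (σ : Fin n → ℤˣ) (v : Vec n) : signSum σ v ≤ √(n : ℝ) * ‖v‖ := by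
  have h1 : signSum σ v ≤ ∑ k, |v k| := by
    refine sum_le_sum fun k _ => ?_
    rcases Int.units_eq_one_or (σ k) with h | h
    · simpa [h] using le_abs_self (v k)
    · simpa [h] using neg_le_abs (v k)
  refine h1.trans ?_
  have h2 := sum_mul_sq_le_sq_mul_sq (univ : Finset (Fin n)) (fun _ => (1 : ℝ)) fun k => |v k|
  simp only [one_mul, sq_abs, one_pow, sum_const, card_univ, Fintype.card_fin, nsmul_eq_mul,
    mul_one, ← EuclideanSpace.real_norm_sq_eq] at h2
  rw [← Real.sqrt_sq (norm_nonneg v), ← Real.sqrt_mul (Nat.cast_nonneg n)]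
  exact Real.le_sqrt_of_sq_le h2

theorem card_signs (n : ℕ) : Fintype.card (Fin n → ℤˣ) = 2 ^ n := by
  simp

theorem sum_units_int {M : Type*} [AddCommMonoid M] (f : ℤˣ → M) :
    ∑ u, f u = f 1 + f (-1) := by
  have : (univ : Finset ℤˣ) = {1, -1} := by decide
  rw [this, sum_pair (by decide)]

/-- Flipping all signs permutes the sign vectors. This removes the base point of the chain. -/
theorem sum_signSum {n : ℕ} (v : Vec n) : ∑ σ : Fin n → ℤˣ, signSum σ v = 0 := by
  have h : ∑ σ : Fin n → ℤˣ, signSum σ v = ∑ σ : Fin n → ℤˣ, signSum (-σ) v :=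
    (Equiv.sum_comp (Equiv.neg (Fin n → ℤˣ)) fun σ => signSum σ v).symm
  have h' : ∀ σ : Fin n → ℤˣ, signSum (-σ) v = -signSum σ v := by
    intro σ
    simp [signSum]
  simp only [h', sum_neg_distrib] at h
  linarith

/-- Independence of the signs: the sum factors over coordinates into `2 cosh (v k)`, and `cosh x ≤
exp (x²/2)`. -/
theorem sum_exp_signSum_le {n : ℕ} (v : Vec n) :
    ∑ σ : Fin n → ℤˣ, Real.exp (signSum σ v) ≤ 2 ^ n * Real.exp (‖v‖ ^ 2 / 2) := by
  have h : ∑ σ : Fin n → ℤˣ, Real.exp (signSum σ v)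
      = ∏ k, ∑ u : ℤˣ, Real.exp (((u : ℤ) : ℝ) * v k) := by
    rw [prod_univ_sum, Fintype.piFinset_univ]
    exact sum_congr rfl fun σ _ => Real.exp_sum _ _
  rw [h]
  calc ∏ k, ∑ u : ℤˣ, Real.exp (((u : ℤ) : ℝ) * v k)
      ≤ ∏ k, 2 * Real.exp (v k ^ 2 / 2) := by
        refine prod_le_prod (fun k _ => sum_nonneg fun _ _ => (Real.exp_pos _).le) fun k _ => ?_
        have := Real.cosh_le_exp_half_sq (v k)
        rw [Real.cosh_eq] at this
        rw [sum_units_int]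
        simp only [Units.val_one, Int.cast_one, one_mul, Units.val_neg, Int.cast_neg, neg_mul]
        linarith
    _ = 2 ^ n * Real.exp (‖v‖ ^ 2 / 2) := by
        rw [prod_mul_distrib, ← Real.exp_sum, ← sum_div, ← EuclideanSpace.real_norm_sq_eq]
        simp

/-- Massart's finite class lemma. -/
theorem massart {n : ℕ} (T : Finset (Vec n)) {r : ℝ} (hr : 0 ≤ r) (hT : ∀ t ∈ T, ‖t‖ ≤ r)
    (F : (Fin n → ℤˣ) → ℝ) (hF : ∀ σ, ∃ t ∈ T, F σ ≤ signSum σ t) :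
    (∑ σ, F σ) / 2 ^ n ≤ r * √(2 * Real.log T.card) := by
  have hcard : 0 < T.card := by
    obtain ⟨t, ht, _⟩ := hF 1
    exact card_pos.2 ⟨t, ht⟩
  have hl : 0 ≤ Real.log T.card := Real.log_natCast_nonneg _
  set x := (∑ σ, F σ) / 2 ^ n with hx
  set l := Real.log T.card with hl'
  have key : ∀ c : ℝ, 0 < c → c * x ≤ l + c ^ 2 * r ^ 2 / 2 := by
    intro c hc
    have h1 : Real.exp (c * x) ≤ (∑ σ : Fin n → ℤˣ, Real.exp (c * F σ)) / 2 ^ n := by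
      have := convexOn_exp.map_sum_le (t := (univ : Finset (Fin n → ℤˣ)))
        (w := fun _ => 1 / 2 ^ n) (p := fun σ => c * F σ) (fun _ _ => by positivity)
        (by simp) (fun _ _ => Set.mem_univ _)
      simp only [smul_eq_mul, ← mul_sum] at this
      have e : c * x = 1 / 2 ^ n * (c * ∑ σ, F σ) := by rw [hx]; ring
      rw [e]
      exact this.trans_eq (by ring)
    have h2 : ∑ σ : Fin n → ℤˣ, Real.exp (c * F σ)
        ≤ T.card * (2 ^ n * Real.exp (c ^ 2 * r ^ 2 / 2)) := by
      calc ∑ σ : Fin n → ℤˣ, Real.exp (c * F σ)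
          ≤ ∑ σ : Fin n → ℤˣ, ∑ t ∈ T, Real.exp (signSum σ (c • t)) := by
            refine sum_le_sum fun σ _ => ?_
            obtain ⟨t, ht, hle⟩ := hF σ
            have e : signSum σ (c • t) = c * signSum σ t := by
              simp only [signSum, PiLp.smul_apply, smul_eq_mul, mul_sum]
              exact sum_congr rfl fun _ _ => by ring
            refine le_trans ?_ (single_le_sum (f := fun t => Real.exp (signSum σ (c • t)))
              (fun _ _ => (Real.exp_pos _).le) ht)
            simp only [e]
            exact Real.exp_le_exp.2 (mul_le_mul_of_nonneg_left hle hc.le)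
        _ = ∑ t ∈ T, ∑ σ : Fin n → ℤˣ, Real.exp (signSum σ (c • t)) := sum_comm
        _ ≤ ∑ t ∈ T, 2 ^ n * Real.exp (c ^ 2 * r ^ 2 / 2) := by
            refine sum_le_sum fun t ht => (sum_exp_signSum_le _).trans ?_
            have : ‖t‖ ^ 2 ≤ r ^ 2 := pow_le_pow_left₀ (norm_nonneg _) (hT t ht) 2
            rw [norm_smul, mul_pow, Real.norm_eq_abs, sq_abs]
            gcongr
        _ = _ := by simp
    have h3 : Real.exp (c * x) ≤ Real.exp (l + c ^ 2 * r ^ 2 / 2) := by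
      rw [Real.exp_add, hl', Real.exp_log (by exact_mod_cast hcard)]
      refine h1.trans ?_
      rw [div_le_iff₀ (by positivity)]
      linarith
    exact Real.exp_le_exp.1 h3
  by_cases hx0 : x ≤ 0
  · exact hx0.trans (by positivity)
  push Not at hx0
  rcases hr.eq_or_lt with h0 | h0
  -- For `r = 0` this choice of `c` would give `l + 1 ≤ l`.
  · have := key ((l + 1) / x) (by positivity)
    rw [← h0, div_mul_cancel₀ _ hx0.ne'] at this
    norm_num at this
  -- This `c` maximises `c * x - c² r² / 2`, and avoids dividing by `l`, which may vanish.
  · have := key (x / r ^ 2) (by positivity)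
    have e : (x / r ^ 2) ^ 2 * r ^ 2 / 2 = x ^ 2 / r ^ 2 / 2 := by field_simp
    have e' : x / r ^ 2 * x = x ^ 2 / r ^ 2 := by ring
    rw [e, e'] at this
    have h4 : x ^ 2 / r ^ 2 ≤ 2 * l := by linarith
    rw [div_le_iff₀ (by positivity)] at h4
    rw [← Real.sqrt_sq h0.le, ← Real.sqrt_mul (by positivity)]
    exact Real.le_sqrt_of_sq_le (by linarith)

/-- Chaining along dyadic covers of a bounded set of vectors. -/
theorem sum_signSum_sup_le {n : ℕ} (V : Set (Vec n)) (v₀ : Vec n) (hv₀ : v₀ ∈ V)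
    (Λ : ℕ → ℝ) (hΛ : Monotone Λ) (hΛ0 : 0 ≤ Λ 0)
    (T : ℕ → Finset (Vec n)) (hT0 : T 0 = {v₀}) (hcard : ∀ j, Real.log (T j).card ≤ Λ j)
    (hcov : ∀ j, ∀ v ∈ V, ∃ t ∈ T j, ‖v - t‖ ≤ √(n : ℝ) * (1 / 2) ^ j) (N : ℕ)
    (F : (Fin n → ℤˣ) → ℝ) (hF : ∀ σ, ∀ a, (∀ v ∈ V, signSum σ v ≤ a) → F σ ≤ a) :
    (∑ σ, F σ) / 2 ^ n ≤
      n * (1 / 2) ^ N + 6 * √(n : ℝ) * ∑ j ∈ range N, (1 / 2) ^ (j + 1) * √(Λ (j + 1)) := by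
  classical
  choose! c hcT hc using hcov
  -- Possible links of the chain between consecutive levels; their length is at most `√n (2^(-j) +
  -- 2^(-(j+1))) = 3 √n 2^(-(j+1))`.
  set P : ℕ → Finset (Vec n × Vec n) := fun j =>
    (T (j + 1) ×ˢ T j).filter fun p => ‖p.1 - p.2‖ ≤ 3 * √(n : ℝ) * (1 / 2) ^ (j + 1)
  have hcP : ∀ j, ∀ v ∈ V, (c (j + 1) v, c j v) ∈ P j := by
    intro j v hv
    simp only [P, mem_filter, mem_product]
    refine ⟨⟨hcT _ _ hv, hcT _ _ hv⟩, ?_⟩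
    have e : c (j + 1) v - c j v = (v - c j v) - (v - c (j + 1) v) := by abel
    rw [e]
    refine (norm_sub_le _ _).trans ((add_le_add (hc j v hv) (hc (j + 1) v hv)).trans (le_of_eq ?_))
    ring
  set Q : ℕ → Finset (Vec n) := fun j => (P j).image fun p => p.1 - p.2
  have hcQ : ∀ j, ∀ v ∈ V, c (j + 1) v - c j v ∈ Q j := fun j v hv =>
    mem_image_of_mem (fun p : Vec n × Vec n => p.1 - p.2) (hcP j v hv)
  have hQne : ∀ j, (Q j).Nonempty := fun j => ⟨_, hcQ j v₀ hv₀⟩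
  set G : ℕ → (Fin n → ℤˣ) → ℝ := fun j σ => (Q j).sup' (hQne j) (signSum σ)
  have hlevel : ∀ j, (∑ σ, G j σ) / 2 ^ n ≤ 6 * √(n : ℝ) * ((1 / 2) ^ (j + 1) * √(Λ (j + 1))) := by
    intro j
    have h1 := massart (Q j) (r := 3 * √(n : ℝ) * (1 / 2) ^ (j + 1)) (by positivity)
      (by
        intro t ht
        obtain ⟨p, hp, rfl⟩ := mem_image.1 ht
        exact (mem_filter.1 hp).2) (G j)
      (by
        intro σ
        obtain ⟨t, ht, h⟩ := exists_mem_eq_sup' (hQne j) (signSum σ)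
        exact ⟨t, ht, h.le⟩)
    refine h1.trans ?_
    have h2 : Real.log (Q j).card ≤ 2 * Λ (j + 1) := by
      have hpos : ∀ i, 0 < (T i).card := fun i => card_pos.2 ⟨_, hcT i v₀ hv₀⟩
      have : (Q j).card ≤ (T (j + 1)).card * (T j).card := by
        rw [← card_product]
        exact card_image_le.trans (card_le_card (filter_subset _ _))
      calc Real.log (Q j).card ≤ Real.log ((T (j + 1)).card * (T j).card) := by
            apply Real.log_le_log
            · exact_mod_cast card_pos.2 (hQne j)
            · exact_mod_cast this
        _ = Real.log (T (j + 1)).card + Real.log (T j).card :=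
            Real.log_mul (by exact_mod_cast (hpos _).ne') (by exact_mod_cast (hpos _).ne')
        _ ≤ 2 * Λ (j + 1) := by
            linarith [hcard (j + 1), hcard j, hΛ (Nat.le_succ j)]
    -- This 2, times the 3 of the link length, is the constant 6.
    have h3 : √(2 * Real.log (Q j).card) ≤ 2 * √(Λ (j + 1)) := by
      rw [Real.sqrt_le_left (by positivity), mul_pow, Real.sq_sqrt (hΛ0.trans (hΛ (Nat.zero_le _)))]
      linarith
    calc _ ≤ 3 * √(n : ℝ) * (1 / 2) ^ (j + 1) * (2 * √(Λ (j + 1))) := by gcongr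
      _ = _ := by ring
  have hbound : ∀ σ, F σ ≤ n * (1 / 2) ^ N + ∑ j ∈ range N, G j σ + signSum σ v₀ := by
    intro σ
    refine hF σ _ fun v hv => ?_
    have tel : ∑ j ∈ range N, (signSum σ (c (j + 1) v - c j v))
        = signSum σ (c N v) - signSum σ (c 0 v) := by
      simp only [signSum_sub]
      exact sum_range_sub (fun j => signSum σ (c j v)) N
    have h0 : c 0 v = v₀ := by
      have := hcT 0 v hv
      rwa [hT0, mem_singleton] at this
    have h1 : signSum σ (v - c N v) ≤ n * (1 / 2) ^ N := by
      refine (signSum_le _ _).trans ((mul_le_mul_of_nonneg_left (hc N v hv) (by positivity)).trans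
        (le_of_eq ?_))
      rw [← mul_assoc, Real.mul_self_sqrt (Nat.cast_nonneg n)]
    have h2 : ∑ j ∈ range N, (signSum σ (c (j + 1) v - c j v)) ≤ ∑ j ∈ range N, G j σ :=
      sum_le_sum fun j _ => le_sup' (signSum σ) (hcQ j v hv)
    rw [signSum_sub] at h1
    rw [tel, h0] at h2
    linarith
  calc (∑ σ, F σ) / 2 ^ n
      ≤ (∑ σ, (n * (1 / 2) ^ N + ∑ j ∈ range N, G j σ + signSum σ v₀)) / 2 ^ n := by
        gcongr with σ
        exact hbound σ
    _ = n * (1 / 2) ^ N + ∑ j ∈ range N, (∑ σ, G j σ) / 2 ^ n := by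
        simp only [sum_add_distrib, sum_signSum, sum_const, card_univ, card_signs, add_zero,
          nsmul_eq_mul, Nat.cast_pow, Nat.cast_ofNat]
        rw [sum_comm, add_div, ← sum_div, mul_div_cancel_left₀ _ (by positivity)]
    _ ≤ _ := by
        rw [mul_sum]
        gcongr with j
        exact hlevel j

/-- Dyadic entropy bound for the empirical Rademacher complexity of a class with values in
`[0, 1]`. -/
theorem rademacher_le {Z : Type*} {n : ℕ} (hn : 0 < n) (S : Fin n → Z) (H : Set (Z → ℝ))
    (hH : ∀ h ∈ H, ∀ z, h z ∈ Set.Icc (0 : ℝ) 1) (Λ : ℕ → ℝ) (hΛ : Monotone Λ) (hΛ0 : 0 ≤ Λ 0)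
    (hcov : ∀ j, ∃ T : Finset (Vec n), Real.log T.card ≤ Λ j ∧
      ∀ h ∈ H, ∃ t ∈ T, ‖WithLp.toLp 2 (fun k => h (S k)) - t‖ ≤ √(n : ℝ) * (1 / 2) ^ j) (N : ℕ) :
    rademacher S H ≤
      (1 / 2) ^ N + 6 / √(n : ℝ) * ∑ j ∈ range N, (1 / 2) ^ (j + 1) * √(Λ (j + 1)) := by
  have hnR : (0 : ℝ) < n := by exact_mod_cast hn
  have hrhs : 0 ≤ (1 / 2) ^ N + 6 / √(n : ℝ) * ∑ j ∈ range N, (1 / 2) ^ (j + 1) * √(Λ (j + 1)) := by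
    positivity
  rcases H.eq_empty_or_nonempty with rfl | ⟨h₀, hh₀⟩
  · simpa [rademacher] using hrhs
  choose T hTc hT using hcov
  set ev : (Z → ℝ) → Vec n := fun h => WithLp.toLp 2 fun k => h (S k) with hev
  have main := sum_signSum_sup_le (ev '' H) (ev h₀) ⟨h₀, hh₀, rfl⟩ Λ hΛ hΛ0
    -- At level 0 one point suffices: values in `[0, 1]` put any two loss vectors within `√n` of
    -- each other.
    (fun j => if j = 0 then {ev h₀} else T j) (by simp)
    (by
      intro j
      by_cases hj : j = 0
      · simpa [hj] using hΛ0
      · simpa [hj] using hTc j)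
    (by
      rintro j _ ⟨h, hh, rfl⟩
      by_cases hj : j = 0
      · refine ⟨ev h₀, by simp [hj], ?_⟩
        simp only [hj, pow_zero, mul_one]
        rw [EuclideanSpace.norm_eq]
        apply Real.sqrt_le_sqrt
        calc ∑ k, ‖(ev h - ev h₀) k‖ ^ 2 ≤ ∑ k : Fin n, (1 : ℝ) := by
              refine sum_le_sum fun k _ => ?_
              have h1 := hH h hh (S k)
              have h2 := hH h₀ hh₀ (S k)
              rw [sq_le_one_iff₀ (norm_nonneg _), Real.norm_eq_abs, abs_le]
              simp only [hev, PiLp.sub_apply]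
              constructor <;> linarith [h1.1, h1.2, h2.1, h2.2]
          _ = n := by simp
      · simpa [hj] using hT j h hh) N
    (fun σ => n * sSup ((fun h : Z → ℝ => (1 / (n : ℝ)) * ∑ k, ((σ k : ℤ) : ℝ) * h (S k)) '' H))
    (by
      intro σ a ha
      rw [← le_div_iff₀' hnR]
      refine csSup_le (Set.Nonempty.image _ ⟨h₀, hh₀⟩) ?_
      rintro _ ⟨h, hh, rfl⟩
      have := ha (ev h) ⟨h, hh, rfl⟩
      simp only [signSum, hev] at this
      simp only
      rw [le_div_iff₀ hnR]
      field_simp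
      exact this)
  rw [← mul_sum, mul_div_assoc] at main
  change n * rademacher S H ≤ _ at main
  rw [← mul_le_mul_iff_right₀ hnR]
  refine main.trans (le_of_eq ?_)
  have : (n : ℝ) / √(n : ℝ) = √(n : ℝ) := Real.div_sqrt
  calc _ = n * (1 / 2) ^ N + 6 * (n / √(n : ℝ)) *
        ∑ j ∈ range N, (1 / 2) ^ (j + 1) * √(Λ (j + 1)) := by rw [this]
    _ = _ := by ring

/-! ### Sparse approximation in convex hulls -/

/-- Maurey's empirical approximation of a convex combination of vectors in a ball. -/
theorem exists_sum_approx {H ι : Type*} [NormedAddCommGroup H] [InnerProductSpace ℝ H] [Fintype ι]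
    (u : ι → H) {R : ℝ} (hu : ∀ i, ‖u i‖ ≤ R) (w : ι → ℝ) (hw0 : ∀ i, 0 ≤ w i)
    (hw1 : ∑ i, w i = 1) (k : ℕ) :
    ∃ f : Fin k → ι, ‖(k : ℝ) • ∑ i, w i • u i - ∑ j, u (f j)‖ ^ 2 ≤ k * R ^ 2 := by
  set x := ∑ i, w i • u i with hx
  induction k with
  | zero => exact ⟨Fin.elim0, by simp⟩
  | succ k ih =>
    obtain ⟨f, hf⟩ := ih
    set y := (k : ℝ) • x - ∑ j, u (f j) with hy
    -- Greedy form of Maurey's random choice: the `w`-average of the left side is `‖y‖² - ‖x‖² + ∑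
    -- w_i ‖u_i‖²`, so some index is no worse than the bound.
    obtain ⟨i, hi⟩ : ∃ i, ‖(y + x) - u i‖ ^ 2 ≤ ‖y‖ ^ 2 + R ^ 2 := by
      by_contra! hcon
      have h1 : ∑ i, w i * (‖y‖ ^ 2 + R ^ 2) < ∑ i, w i * ‖(y + x) - u i‖ ^ 2 := by
        refine sum_lt_sum (fun i _ => mul_le_mul_of_nonneg_left (hcon i).le (hw0 i)) ?_
        obtain ⟨i, hi, hpos⟩ := exists_lt_of_sum_lt (s := univ) (f := fun _ : ι => (0 : ℝ)) (g := w)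
          (by simp [hw1])
        exact ⟨i, hi, mul_lt_mul_of_pos_left (hcon i) hpos⟩
      rw [← sum_mul, hw1, one_mul] at h1
      have h2 : ∑ i, w i * ‖(y + x) - u i‖ ^ 2
          = ‖y + x‖ ^ 2 - 2 * inner ℝ (y + x) x + ∑ i, w i * ‖u i‖ ^ 2 := by
        have e : inner ℝ (y + x) x = ∑ i, w i * inner ℝ (y + x) (u i) := by
          conv_lhs => rw [hx]
          rw [inner_sum]
          simp only [inner_smul_right, ← hx]
        have e' : ‖y + x‖ ^ 2 = ∑ i, w i * ‖y + x‖ ^ 2 := by rw [← sum_mul, hw1, one_mul]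
        rw [e, e', mul_sum, ← sum_sub_distrib, ← sum_add_distrib]
        refine sum_congr rfl fun i _ => ?_
        rw [norm_sub_sq_real]
        ring
      have h3 : ∑ i, w i * ‖u i‖ ^ 2 ≤ R ^ 2 := by
        calc ∑ i, w i * ‖u i‖ ^ 2 ≤ ∑ i, w i * R ^ 2 :=
              sum_le_sum fun i _ => mul_le_mul_of_nonneg_left
                (pow_le_pow_left₀ (norm_nonneg _) (hu i) 2) (hw0 i)
          _ = R ^ 2 := by rw [← sum_mul, hw1, one_mul]
      have h4 : ‖y + x‖ ^ 2 - 2 * inner ℝ (y + x) x = ‖y‖ ^ 2 - ‖x‖ ^ 2 := by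
        rw [norm_add_sq_real, inner_add_left, real_inner_self_eq_norm_sq]
        ring
      nlinarith [sq_nonneg ‖x‖]
    refine ⟨Fin.cons i f, ?_⟩
    have e : ((k + 1 : ℕ) : ℝ) • x - ∑ j, u ((Fin.cons i f : Fin (k + 1) → ι) j)
        = (y + x) - u i := by
      rw [Fin.sum_univ_succ]
      simp only [Fin.cons_zero, Fin.cons_succ, hy, Nat.cast_add, Nat.cast_one, add_smul, one_smul]
      abel
    rw [e]
    push_cast
    linarith

/-- A cover of a finitely generated convex hull. -/
theorem exists_cover_convexCombination {H ι : Type*} [NormedAddCommGroup H] [InnerProductSpace ℝ H]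
    [Fintype ι] (u : ι → H) {R : ℝ} (hR : 0 ≤ R) (hu : ∀ i, ‖u i‖ ≤ R) {k : ℕ} (hk : k ≠ 0) :
    ∃ T : Finset H, T.card ≤ Fintype.card ι ^ k ∧ T.card ≤ (k + 1) ^ Fintype.card ι ∧
      ∀ w : ι → ℝ, (∀ i, 0 ≤ w i) → ∑ i, w i = 1 → ∃ t ∈ T, ‖∑ i, w i • u i - t‖ ≤ R / √(k : ℝ) := by
  classical
  refine ⟨univ.image fun f : Fin k → ι => (k : ℝ)⁻¹ • ∑ j, u (f j), ?_, ?_, ?_⟩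
  · exact card_image_le.trans (by simp)
  -- The average depends on `f` only through the multiplicity of each index, a number from `0` to
  -- `k`.
  · have hsub : (univ.image fun f : Fin k → ι => (k : ℝ)⁻¹ • ∑ j, u (f j)) ⊆
        univ.image fun m : ι → Fin (k + 1) => (k : ℝ)⁻¹ • ∑ i, (m i : ℕ) • u i := by
      intro t ht
      obtain ⟨f, -, rfl⟩ := mem_image.1 ht
      refine mem_image.2 ⟨fun i => ⟨(univ.filter fun j => f j = i).card, ?_⟩, mem_univ _, ?_⟩
      · exact Nat.lt_succ_of_le ((card_le_univ _).trans (by simp))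
      · congr 1
        rw [← sum_fiberwise_of_maps_to (g := f) (fun j _ => mem_univ (f j))]
        refine sum_congr rfl fun i _ => ?_
        rw [sum_congr rfl fun j hj => by rw [(mem_filter.1 hj).2], sum_const]
    exact (card_le_card hsub).trans (card_image_le.trans (by simp))
  · intro w hw0 hw1
    obtain ⟨f, hf⟩ := exists_sum_approx u hu w hw0 hw1 k
    refine ⟨_, mem_image_of_mem _ (mem_univ f), ?_⟩
    have hk' : (0 : ℝ) < k := by exact_mod_cast Nat.pos_of_ne_zero hk
    have e : ∑ i, w i • u i - (k : ℝ)⁻¹ • ∑ j, u (f j)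
        = (k : ℝ)⁻¹ • ((k : ℝ) • ∑ i, w i • u i - ∑ j, u (f j)) := by
      rw [smul_sub, smul_smul, inv_mul_cancel₀ hk'.ne', one_smul]
    rw [e, norm_smul, norm_inv, Real.norm_natCast, inv_mul_le_iff₀ hk']
    have h1 : ‖(k : ℝ) • ∑ i, w i • u i - ∑ j, u (f j)‖ ≤ √(k : ℝ) * R := by
      refine abs_le_of_sq_le_sq' ?_ (by positivity) |>.2
      rw [mul_pow, Real.sq_sqrt hk'.le]
      exact hf
    refine h1.trans (le_of_eq ?_)
    have : (k : ℝ) / √(k : ℝ) = √(k : ℝ) := Real.div_sqrt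
    rw [mul_div_left_comm, this, mul_comm]

/-- A cover of the set of combinations `∑ a_i w_i` with `∑ |a_i| ‖w_i‖ ≤ B`. -/
theorem exists_cover_combination {H ι : Type*} [NormedAddCommGroup H] [InnerProductSpace ℝ H]
    [Fintype ι] [Nonempty ι] (w : ι → H) {B : ℝ} (hB : 0 ≤ B) {k : ℕ} (hk : k ≠ 0) :
    ∃ T : Finset H, T.card ≤ (2 * Fintype.card ι) ^ k ∧ T.card ≤ (k + 1) ^ (2 * Fintype.card ι) ∧
      ∀ a : ι → ℝ, ∑ i, |a i| * ‖w i‖ ≤ B → ∃ t ∈ T, ‖∑ i, a i • w i - t‖ ≤ B / √(k : ℝ) := by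
  have hcard : Fintype.card (ℤˣ × ι) = 2 * Fintype.card ι := by simp
  -- Generators rescaled to length `B`, with both signs; a zero `w i` stays zero because `0⁻¹ = 0`.
  set v : ℤˣ × ι → H := fun p => (((p.1 : ℤ) : ℝ) * (B * ‖w p.2‖⁻¹)) • w p.2 with hv
  have hvB : ∀ p, ‖v p‖ ≤ B := by
    rintro ⟨e, i⟩
    have he : |((e : ℤ) : ℝ)| = 1 := by rcases Int.units_eq_one_or e with h | h <;> simp [h]
    simp only [hv, norm_smul, norm_mul, Real.norm_eq_abs, he, one_mul, abs_of_nonneg hB, abs_inv,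
      abs_norm]
    rw [mul_assoc]
    exact mul_le_of_le_one_right hB (inv_mul_le_one)
  obtain ⟨T, h1, h2, h3⟩ := exists_cover_convexCombination v hB hvB hk
  rw [hcard] at h1 h2
  refine ⟨T, h1, h2, fun a ha => ?_⟩
  set c : ι → ℝ := fun i => B⁻¹ * (a i * ‖w i‖) with hc
  have hcsum : ∑ i, |c i| ≤ 1 := by
    have : ∑ i, |c i| = B⁻¹ * ∑ i, |a i| * ‖w i‖ := by
      rw [mul_sum]
      refine sum_congr rfl fun i _ => ?_
      simp only [hc, abs_mul, abs_inv, abs_of_nonneg hB, abs_norm]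
    rw [this]
    exact (mul_le_mul_of_nonneg_left ha (inv_nonneg.2 hB)).trans inv_mul_le_one
  have hι : (0 : ℝ) < Fintype.card ι := by exact_mod_cast Fintype.card_pos
  -- The missing mass is spread evenly over all signed generators; opposite signs cancel, so the
  -- combination does not change.
  set r : ℝ := (1 - ∑ i, |c i|) / (2 * Fintype.card ι) with hr
  have hr0 : 0 ≤ r := div_nonneg (by linarith) (by positivity)
  obtain ⟨t, ht, hle⟩ := h3 (fun p => max (((p.1 : ℤ) : ℝ) * c p.2) 0 + r)
    (fun p => add_nonneg (le_max_right _ _) hr0)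
    (by
      have habs : ∀ x : ℝ, max x 0 + max (-x) 0 = |x| := fun x => by
        rcases le_total 0 x with h | h
        · rw [max_eq_left h, max_eq_right (by linarith), abs_of_nonneg h, add_zero]
        · rw [max_eq_right h, max_eq_left (by linarith), abs_of_nonpos h, zero_add]
      rw [Fintype.sum_prod_type_right]
      simp only [sum_units_int, Units.val_one, Int.cast_one, one_mul, Units.val_neg, Int.cast_neg,
        neg_mul]
      calc ∑ i, (max (c i) 0 + r + (max (-c i) 0 + r)) = ∑ i, (|c i| + 2 * r) :=
            sum_congr rfl fun i _ => by rw [← habs]; ring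
        _ = 1 := by
            rw [sum_add_distrib, sum_const, card_univ, nsmul_eq_mul, hr]
            field_simp
            ring)
  refine ⟨t, ht, ?_⟩
  convert hle using 3
  have hsub : ∀ x : ℝ, max x 0 - max (-x) 0 = x := fun x => by
    rcases le_total 0 x with h | h
    · rw [max_eq_left h, max_eq_right (by linarith), sub_zero]
    · rw [max_eq_right h, max_eq_left (by linarith)]; ring
  rw [Fintype.sum_prod_type_right]
  refine sum_congr rfl fun i _ => ?_
  simp only [sum_units_int, Units.val_one, Int.cast_one, one_mul, Units.val_neg, Int.cast_neg,
    neg_mul, hv, smul_smul, ← add_smul]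
  have e : (max (c i) 0 + r) * (B * ‖w i‖⁻¹) + (max (-c i) 0 + r) * -(B * ‖w i‖⁻¹)
      = c i * (B * ‖w i‖⁻¹) := by
    conv_rhs => rw [← hsub (c i)]
    ring
  rw [e]
  by_cases hw : w i = 0
  · simp [hw]
  have hw' : ‖w i‖ ≠ 0 := norm_ne_zero_iff.2 hw
  -- For `B = 0` the coefficients `c` are all zero, and the hypothesis forces `a i = 0` as well.
  by_cases hB0 : B = 0
  · have : |a i| * ‖w i‖ ≤ 0 := by
      rw [← hB0]
      exact (single_le_sum (f := fun i => |a i| * ‖w i‖) (fun _ _ => by positivity)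
        (mem_univ i)).trans ha
    have : a i = 0 := by
      by_contra h
      have : 0 < |a i| * ‖w i‖ := by positivity
      linarith
    simp [this, hc]
  · congr 1
    simp only [hc]
    field_simp

/-- External covers of the image of a set yield internal covers of twice the radius. -/
theorem exists_internal_cover {K H : Type*} [NormedAddCommGroup H] (P : K → Prop) (φ : K → H)
    (T : Finset H) {δ : ℝ} (hT : ∀ w, P w → ∃ t ∈ T, ‖φ w - t‖ ≤ δ) :
    ∃ U : Finset K, U.card ≤ T.card ∧ (∀ w ∈ U, P w) ∧
      ∀ w, P w → ∃ w' ∈ U, ‖φ w - φ w'‖ ≤ 2 * δ := by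
  classical
  by_cases hne : ∃ w, P w
  swap
  · push Not at hne
    exact ⟨∅, by simp, by simp, fun w hw => absurd hw (hne w)⟩
  obtain ⟨w₀, hw₀⟩ := hne
  -- Each centre is traded for an admissible point of its ball, or for the dummy `w₀` if there is
  -- none.
  have hrep : ∀ t, ∃ w, P w ∧ ((∃ w', P w' ∧ ‖φ w' - t‖ ≤ δ) → ‖φ w - t‖ ≤ δ) := by
    intro t
    by_cases h : ∃ w', P w' ∧ ‖φ w' - t‖ ≤ δ
    · obtain ⟨w', h1, h2⟩ := h
      exact ⟨w', h1, fun _ => h2⟩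
    · exact ⟨w₀, hw₀, fun h' => absurd h' h⟩
  choose rep hP hd using hrep
  refine ⟨T.image rep, card_image_le, ?_, ?_⟩
  · intro w hw
    obtain ⟨t, -, rfl⟩ := mem_image.1 hw
    exact hP t
  · intro w hw
    obtain ⟨t, ht, hle⟩ := hT w hw
    refine ⟨rep t, mem_image_of_mem _ ht, ?_⟩
    have e : φ w - φ (rep t) = (φ w - t) - (φ (rep t) - t) := by abel
    rw [e, two_mul]
    exact (norm_sub_le _ _).trans (add_le_add hle (hd t ⟨w, hw, hle⟩))

/-! ### Samples of vectors -/

/-- Samples of `n` vectors, with the Euclidean norm. -/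
abbrev Sample (n d : ℕ) : Type := PiLp 2 fun _ : Fin n => Vec d

/-- The pointwise action of a map on a sample. -/
def mapSample {n d m : ℕ} (f : Vec d → Vec m) (X : Sample n d) : Sample n m :=
  WithLp.toLp 2 fun k => f (X k)

theorem mapSample_zero {n d m : ℕ} {f : Vec d → Vec m} (hf : f 0 = 0) :
    mapSample f (0 : Sample n d) = 0 := by
  ext k : 1
  simp [mapSample, hf]

theorem mapSample_norm_sub_le {n d m : ℕ} {f : Vec d → Vec m} {K : ℝ≥0} (hf : LipschitzWith K f)
    (X Y : Sample n d) : ‖mapSample f X - mapSample f Y‖ ≤ K * ‖X - Y‖ := by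
  refine abs_le_of_sq_le_sq' ?_ (by positivity) |>.2
  rw [mul_pow, PiLp.norm_sq_eq_of_L2, PiLp.norm_sq_eq_of_L2, mul_sum]
  refine sum_le_sum fun k _ => ?_
  rw [← mul_pow]
  exact pow_le_pow_left₀ (norm_nonneg _) (hf.norm_sub_le (X k) (Y k)) 2

theorem mapSample_norm_le {n d m : ℕ} {f : Vec d → Vec m} {K : ℝ≥0} (hf : LipschitzWith K f)
    (h0 : f 0 = 0) (X : Sample n d) : ‖mapSample f X‖ ≤ K * ‖X‖ := by
  simpa [mapSample_zero h0] using mapSample_norm_sub_le hf X 0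

theorem Sample.norm_sq {n d : ℕ} (X : Sample n d) : ‖X‖ ^ 2 = ∑ k, ∑ r, X k r ^ 2 := by
  rw [PiLp.norm_sq_eq_of_L2]
  exact sum_congr rfl fun k _ => EuclideanSpace.real_norm_sq_eq _

/-! ### Layers as combinations of finitely many linear maps -/

/-- Cauchy-Schwarz in each group; this is where the (2,1) norm of the weights appears. -/
theorem group_sum_le {G R : Type*} [Fintype G] [Fintype R] (B : G → R → ℝ) (x : R → ℝ)
    {D : ℝ} (hx : ∑ r, x r ^ 2 ≤ D ^ 2) (hD : 0 ≤ D) :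
    ∑ g, ∑ r, |B g r| * x r ≤ (∑ g, √(∑ r, B g r ^ 2)) * D := by
  rw [sum_mul]
  refine sum_le_sum fun g _ => ?_
  have h := Real.sum_mul_le_sqrt_mul_sqrt univ (fun r => |B g r|) x
  simp only [sq_abs] at h
  refine h.trans (mul_le_mul_of_nonneg_left ?_ (Real.sqrt_nonneg _))
  exact (Real.sqrt_le_sqrt hx).trans (Real.sqrt_sq hD).le

/-- The generator for the entry `(p, r)` copies input feature `r` of the sample into output `p`. Its
norm depends only on `r`, and the squares of these norms over `r` add up to `‖X‖²`. -/
theorem matrix_decomposition {n d m : ℕ} (M : Matrix (Fin m) (Fin d) ℝ) (X : Sample n d) :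
    ∃ w : Fin m × Fin d → Sample n m, ∀ A : Matrix (Fin m) (Fin d) ℝ, ∃ a : Fin m × Fin d → ℝ,
      ∑ i, |a i| * ‖w i‖ ≤ matNorm (Aᵀ - Mᵀ) * ‖X‖ ∧
      mapSample (Layer.full.apply A) X = mapSample (Layer.full.apply M) X + ∑ i, a i • w i := by
  set w : Fin m × Fin d → Sample n m :=
    fun i => WithLp.toLp 2 fun k => EuclideanSpace.single i.1 (X k i.2) with hw
  have hnorm : ∀ i, ‖w i‖ = √(∑ k, X k i.2 ^ 2) := by
    intro i
    rw [PiLp.norm_eq_of_L2]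
    simp [hw]
  refine ⟨w, fun A => ⟨fun i => (A - M) i.1 i.2, ?_, ?_⟩⟩
  · rw [Fintype.sum_prod_type]
    simp only [hnorm]
    refine (group_sum_le (A - M) (fun r => √(∑ k, X k r ^ 2)) (D := ‖X‖) (le_of_eq ?_)
      (norm_nonneg _)).trans (le_of_eq ?_)
    · rw [Sample.norm_sq, sum_comm]
      exact sum_congr rfl fun r _ => Real.sq_sqrt (sum_nonneg fun _ _ => sq_nonneg _)
    · rfl
  · ext k p
    simp only [mapSample, Layer.apply, hw, PiLp.add_apply, WithLp.ofLp_sum, WithLp.ofLp_smul,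
      Finset.sum_apply, Pi.smul_apply, smul_eq_mul, Matrix.mulVec, dotProduct,
      PiLp.single_apply, Fintype.sum_prod_type]
    simp [← sum_add_distrib]
    exact sum_congr rfl fun r _ => by ring

/-- `R` is a partial matching, so the left side only reindexes some of the squares on the right. -/
theorem sum_sq_sum_ite_le {P Q : Type*} [Fintype P] [Fintype Q] (R : P → Q → Prop)
    [∀ p q, Decidable (R p q)] (h1 : ∀ p q q', R p q → R p q' → q = q')
    (h2 : ∀ p p' q, R p q → R p' q → p = p') (x : Q → ℝ) :
    ∑ p, (∑ q, if R p q then x q else 0) ^ 2 ≤ ∑ q, x q ^ 2 := by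
  calc ∑ p, (∑ q, if R p q then x q else 0) ^ 2
      ≤ ∑ p, ∑ q, if R p q then x q ^ 2 else 0 := by
        refine sum_le_sum fun p _ => ?_
        by_cases h : ∃ q, R p q
        · obtain ⟨q, hq⟩ := h
          have e : ∀ f : Q → ℝ, (∑ q', if R p q' then f q' else 0) = f q := fun f => by
            rw [sum_eq_single q (fun q' _ hne => if_neg fun h' => hne (h1 p _ _ h' hq))
              (fun h => absurd (mem_univ _) h), if_pos hq]
          rw [e, e fun q => x q ^ 2]
        · push Not at h
          simp [h]
    _ = ∑ q, ∑ p, if R p q then x q ^ 2 else 0 := sum_comm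
    _ ≤ ∑ q, x q ^ 2 := by
        refine sum_le_sum fun q _ => ?_
        by_cases h : ∃ p, R p q
        · obtain ⟨p, hp⟩ := h
          rw [sum_eq_single p (fun p' _ hne => if_neg fun h' => hne (h2 _ _ q h' hp))
              (fun h => absurd (mem_univ _) h), if_pos hp]
        · push Not at h
          simp [h, sq_nonneg]

namespace ConvGeometry

variable {d m : ℕ} (c : ConvGeometry d m)

/-- At a fixed kernel position, distinct output pixels read distinct input pixels, because the
strides are positive. -/
theorem sum_pixel_sq_le (x : Vec d) (r : Fin c.cin) (a : Fin c.kh) (b : Fin c.kw) :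
    ∑ q : Fin c.hOut × Fin c.wOut, c.pixel x r q.1 q.2 a b ^ 2
      ≤ ∑ β : Fin c.h × Fin c.w, x (c.ein.symm (r, β)) ^ 2 := by
  refine le_trans (le_of_eq ?_) (sum_sq_sum_ite_le
    (fun (q : Fin c.hOut × Fin c.wOut) (β : Fin c.h × Fin c.w) =>
      c.strideH * (q.1 : ℕ) + a = β.1 + c.padH ∧ c.strideW * (q.2 : ℕ) + b = β.2 + c.padW)
    ?_ ?_ _)
  · refine sum_congr rfl fun q _ => ?_
    rw [Fintype.sum_prod_type]
    rfl
  · rintro q ⟨β, δ⟩ ⟨β', δ'⟩ ⟨h1, h2⟩ ⟨h3, h4⟩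
    simp only [Prod.mk.injEq, Fin.ext_iff] at *
    omega
  · rintro ⟨μ, ν⟩ ⟨μ', ν'⟩ β ⟨h1, h2⟩ ⟨h3, h4⟩
    simp only [Prod.mk.injEq, Fin.ext_iff] at *
    have e1 : c.strideH * (μ : ℕ) = c.strideH * (μ' : ℕ) := by omega
    have e2 : c.strideW * (ν : ℕ) = c.strideW * (ν' : ℕ) := by omega
    exact ⟨Nat.eq_of_mul_eq_mul_left c.strideH_pos e1, Nat.eq_of_mul_eq_mul_left c.strideW_pos e2⟩

/-- The generator for one tensor entry copies a shifted input channel into an output channel, so its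
norm is at most that of the input channel. Hence neither image size nor kernel size enters the
bound. -/
theorem decomposition {n : ℕ} (M : c.Tensor) (X : Sample n d) :
    ∃ w : (Fin c.cout × Fin c.kh × Fin c.kw) × Fin c.cin → Sample n m, ∀ K : c.Tensor,
      ∃ a : (Fin c.cout × Fin c.kh × Fin c.kw) × Fin c.cin → ℝ,
        ∑ i, |a i| * ‖w i‖ ≤ c.tensorNorm (K - M) * ‖X‖ ∧
        mapSample (c.conv K) X = mapSample (c.conv M) X + ∑ i, a i • w i := by
  set w : (Fin c.cout × Fin c.kh × Fin c.kw) × Fin c.cin → Sample n m :=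
    fun i => WithLp.toLp 2 fun k => WithLp.toLp 2 fun o =>
      if (c.eout o).1 = i.1.1 then
        c.pixel (X k) i.2 (c.eout o).2.1 (c.eout o).2.2 i.1.2.1 i.1.2.2 else 0 with hw
  set ch : Fin c.cin → ℝ :=
    fun r => √(∑ k, ∑ β : Fin c.h × Fin c.w, X k (c.ein.symm (r, β)) ^ 2) with hch
  have hch2 : ∑ r, ch r ^ 2 = ‖X‖ ^ 2 := by
    rw [Sample.norm_sq]
    simp only [hch]
    calc _ = ∑ r, ∑ k, ∑ β : Fin c.h × Fin c.w, X k (c.ein.symm (r, β)) ^ 2 :=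
          sum_congr rfl fun r _ => Real.sq_sqrt (by positivity)
      _ = ∑ k, ∑ r, ∑ β : Fin c.h × Fin c.w, X k (c.ein.symm (r, β)) ^ 2 := sum_comm
      _ = _ := by
          refine sum_congr rfl fun k _ => ?_
          rw [← Fintype.sum_prod_type (f := fun q : Fin c.cin × Fin c.h × Fin c.w =>
            X k (c.ein.symm q) ^ 2)]
          exact Equiv.sum_comp c.ein.symm fun r => X k r ^ 2
  have hnorm : ∀ i, ‖w i‖ ≤ ch i.2 := by
    rintro ⟨⟨p, a, b⟩, r⟩
    refine Real.le_sqrt_of_sq_le ?_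
    rw [Sample.norm_sq]
    refine sum_le_sum fun k _ => le_trans (le_of_eq ?_) (c.sum_pixel_sq_le (X k) r a b)
    simp only [hw]
    rw [Equiv.sum_comp c.eout (fun o : Fin c.cout × Fin c.hOut × Fin c.wOut =>
      (if o.1 = p then c.pixel (X k) r o.2.1 o.2.2 a b else 0) ^ 2), Fintype.sum_prod_type]
    simp only [ite_pow, ne_eq, OfNat.ofNat_ne_zero, not_false_eq_true, zero_pow]
    rw [sum_comm]
    simp
  refine ⟨w, fun K => ⟨fun i => (K - M) i.1.1 i.2 i.1.2.1 i.1.2.2, ?_, ?_⟩⟩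
  · rw [Fintype.sum_prod_type]
    calc _ ≤ ∑ g : Fin c.cout × Fin c.kh × Fin c.kw, ∑ r, |(K - M) g.1 r g.2.1 g.2.2| * ch r :=
          sum_le_sum fun g _ => sum_le_sum fun r _ =>
            mul_le_mul_of_nonneg_left (hnorm (g, r)) (abs_nonneg _)
      _ ≤ _ := group_sum_le (fun (g : Fin c.cout × Fin c.kh × Fin c.kw) r =>
            (K - M) g.1 r g.2.1 g.2.2) ch hch2.le (norm_nonneg _)
      _ = _ := by simp only [Fintype.sum_prod_type, tensorNorm]
  · ext k o
    simp only [mapSample, conv, hw, PiLp.add_apply, WithLp.ofLp_sum, WithLp.ofLp_smul,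
      Finset.sum_apply, Pi.smul_apply, smul_eq_mul, Fintype.sum_prod_type,
      Pi.sub_apply, mul_ite, mul_zero]
    have e : ∀ p, (∑ a, ∑ b, ∑ r, if (c.eout o).1 = p then
          (K p r a b - M p r a b) * c.pixel (X k) r (c.eout o).2.1 (c.eout o).2.2 a b else 0)
        = if (c.eout o).1 = p then ∑ a, ∑ b, ∑ r,
          (K p r a b - M p r a b) * c.pixel (X k) r (c.eout o).2.1 (c.eout o).2.2 a b else 0 := by
      intro p
      split_ifs <;> simp
    simp only [e, sum_ite_eq, mem_univ, if_true]
    have e' : ∀ f : Fin c.cin → Fin c.kh → Fin c.kw → ℝ,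
        ∑ a, ∑ b, ∑ r, f r a b = ∑ r, ∑ a, ∑ b, f r a b := by
      intro f
      exact (sum_congr rfl fun a _ => sum_comm).trans sum_comm
    rw [e' fun r a b => (K (c.eout o).1 r a b - M (c.eout o).1 r a b) *
      c.pixel (X k) r (c.eout o).2.1 (c.eout o).2.2 a b]
    simp only [← sum_add_distrib]
    refine sum_congr rfl fun r _ => sum_congr rfl fun a _ => sum_congr rfl fun b _ => ?_
    ring

end ConvGeometry

/-! ### Covers of a layer -/

/-- A bound for the size of a cover of a layer with `W` parameters by `k`-sparse combinations. -/
def coverSize (W k : ℕ) : ℕ :=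
  if W = 0 then 1 else min ((2 * W) ^ k) ((k + 1) ^ (2 * W))

theorem coverSize_pos (W k : ℕ) : 0 < coverSize W k := by
  unfold coverSize
  split_ifs with h
  · exact one_pos
  · have : 0 < 2 * W := by omega
    exact lt_min (pow_pos this _) (by positivity)

theorem log_coverSize_le_mul_log_params (W k : ℕ) :
    Real.log (coverSize W k) ≤ k * Real.log (2 * W) := by
  unfold coverSize
  split_ifs with h
  · simp [h]
  · have hW : 0 < 2 * W := by omega
    rw [← Real.log_pow]
    refine Real.log_le_log ?_ ?_
    · exact_mod_cast lt_min (pow_pos hW _) (by positivity)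
    · exact_mod_cast min_le_left _ _

theorem log_coverSize_le_mul_log_sparsity (W k : ℕ) :
    Real.log (coverSize W k) ≤ 2 * W * Real.log (1 + k) := by
  unfold coverSize
  split_ifs with h
  · simp [h]
  · have hW : 0 < 2 * W := by omega
    have e : (2 * W * Real.log (1 + k) : ℝ) = Real.log (((k + 1) ^ (2 * W) : ℕ) : ℝ) := by
      push_cast
      rw [Real.log_pow]
      push_cast
      rw [add_comm]
    rw [e]
    refine Real.log_le_log ?_ ?_
    · exact_mod_cast lt_min (pow_pos hW _) (by positivity)
    · exact_mod_cast min_le_right _ _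

/-- The relative radius of the cover by `k`-sparse combinations of a layer with Lipschitz constraint
`s` and distance constraint `b`. -/
noncomputable def coverRadius (s b : ℝ) (k : ℕ) : ℝ :=
  if k = 0 then 2 * s else 2 * (b / √(k : ℝ))

namespace Layer

variable {d m : ℕ} (ℓ : Layer d m)

theorem exists_decomposition {n : ℕ} (M : ℓ.Weight) (X : Sample n d) :
    ∃ (ι : Type) (_ : Fintype ι), Fintype.card ι = ℓ.numParams ∧
      ∃ w : ι → Sample n m, ∀ K, ∃ a : ι → ℝ, ∑ i, |a i| * ‖w i‖ ≤ ℓ.weightDist K M * ‖X‖ ∧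
        mapSample (ℓ.apply K) X = mapSample (ℓ.apply M) X + ∑ i, a i • w i := by
  cases ℓ with
  | full => exact ⟨_, inferInstance, by simp [numParams], matrix_decomposition M X⟩
  | conv c =>
    refine ⟨_, inferInstance, ?_, c.decomposition M X⟩
    simp only [Fintype.card_prod, Fintype.card_fin, numParams]
    ring

theorem apply_zero (K : ℓ.Weight) : ℓ.apply K 0 = 0 := by
  cases ℓ with
  | full =>
    ext i
    exact congrFun (Matrix.mulVec_zero (K : Matrix (Fin m) (Fin d) ℝ)) i
  | conv c => ext; simp [apply, ConvGeometry.conv, ConvGeometry.pixel]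

/-- Maurey's cover of the difference to the reference output, made internal. One weight suffices if
there are no parameters (all outputs agree) or if `k = 0` (two `s`-Lipschitz layers fixing zero
differ by at most `2 s ‖X‖`). -/
theorem exists_cover {n : ℕ} (M : ℓ.Weight) (s : ℝ≥0) {b : ℝ} (hb : 0 ≤ b) (k : ℕ)
    (X : Sample n d) :
    ∃ U : Finset ℓ.Weight, U.card ≤ coverSize ℓ.numParams k ∧
      (∀ K ∈ U, LipschitzWith s (ℓ.apply K) ∧ ℓ.weightDist K M ≤ b) ∧
      ∀ K, LipschitzWith s (ℓ.apply K) ∧ ℓ.weightDist K M ≤ b →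
        ∃ K' ∈ U, ‖mapSample (ℓ.apply K) X - mapSample (ℓ.apply K') X‖ ≤ coverRadius s b k * ‖X‖ := by
  obtain ⟨ι, _, hι, w, hw⟩ := ℓ.exists_decomposition M X
  set P : ℓ.Weight → Prop := fun K => LipschitzWith s (ℓ.apply K) ∧ ℓ.weightDist K M ≤ b with hP
  have hsum : ∀ K, P K → ∃ a : ι → ℝ, ∑ i, |a i| * ‖w i‖ ≤ b * ‖X‖ ∧
      mapSample (ℓ.apply K) X = mapSample (ℓ.apply M) X + ∑ i, a i • w i := by
    intro K hK
    obtain ⟨a, h1, h2⟩ := hw K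
    exact ⟨a, h1.trans (mul_le_mul_of_nonneg_right hK.2 (norm_nonneg _)), h2⟩
  by_cases htriv : ℓ.numParams = 0 ∨ k = 0
  · by_cases hne : ∃ K₀, P K₀
    · obtain ⟨K₀, hK₀⟩ := hne
      refine ⟨{K₀}, ?_, by simpa using hK₀, fun K hK => ⟨K₀, by simp, ?_⟩⟩
      · simpa using Nat.one_le_iff_ne_zero.2 (coverSize_pos _ _).ne'
      · have hr : 0 ≤ coverRadius s b k := by
          unfold coverRadius
          split_ifs <;> positivity
        by_cases hW : ℓ.numParams = 0
        · rw [hW, Fintype.card_eq_zero_iff] at hι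
          obtain ⟨a, -, h⟩ := hsum K hK
          obtain ⟨a', -, h'⟩ := hsum K₀ hK₀
          rw [h, h']
          simp only [univ_eq_empty, sum_empty, sub_self, norm_zero]
          positivity
        · have hk := htriv.resolve_left hW
          simp only [coverRadius, hk, if_true, two_mul, add_mul]
          exact (norm_sub_le _ _).trans (add_le_add
            (mapSample_norm_le hK.1 (ℓ.apply_zero K) X)
            (mapSample_norm_le hK₀.1 (ℓ.apply_zero K₀) X))
    · push Not at hne
      exact ⟨∅, by simp, by simp, fun K hK => absurd hK (hne K)⟩
  · push Not at htriv
    obtain ⟨hW, hk⟩ := htriv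
    have : Nonempty ι := Fintype.card_pos_iff.1 (by omega)
    obtain ⟨T, h1, h2, h3⟩ := exists_cover_combination w (B := b * ‖X‖) (by positivity) hk
    rw [hι] at h1 h2
    obtain ⟨U, hU1, hU2, hU3⟩ := exists_internal_cover P
      (fun K => mapSample (ℓ.apply K) X - mapSample (ℓ.apply M) X) T
      (δ := b * ‖X‖ / √(k : ℝ)) (by
        intro K hK
        obtain ⟨a, ha, e⟩ := hsum K hK
        simp only [e, add_sub_cancel_left]
        exact h3 a ha)
    refine ⟨U, ?_, hU2, fun K hK => ?_⟩
    · simp only [coverSize, hW, if_false]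
      exact hU1.trans (le_min h1 h2)
    · obtain ⟨K', hK', hle⟩ := hU3 K hK
      refine ⟨K', hK', ?_⟩
      simp only [coverRadius, hk, if_false, sub_sub_sub_cancel_right] at hle ⊢
      exact hle.trans (le_of_eq (by ring))

end Layer

/-! ### Covers of compositions -/

/-- The maps `F x`, for `x` with `P x`, have at each point `Y` a cover of size `N` and radius
`e * ‖Y‖`. -/
def HasCover {w E E' : Type*} [NormedAddCommGroup E] [NormedAddCommGroup E'] (P : w → Prop)
    (F : w → E → E') (e : ℝ) (N : ℕ) : Prop :=
  ∀ Y, ∃ U : Finset w, U.card ≤ N ∧ (∀ x ∈ U, P x) ∧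
    ∀ x, P x → ∃ x' ∈ U, ‖F x Y - F x' Y‖ ≤ e * ‖Y‖

section Composition

variable {w E : ℕ → Type*}

/-- The composition of the first `j` stages of a sequence of parametrized maps. -/
def comp (F : ∀ j, w j → E j → E (j + 1)) (θ : ∀ j, w j) : (j : ℕ) → E 0 → E j
  | 0 => fun Y => Y
  | j + 1 => fun Y => F j (θ j) (comp F θ j Y)

theorem comp_congr (F : ∀ j, w j → E j → E (j + 1)) {θ θ' : ∀ j, w j} {J : ℕ}
    (h : ∀ j < J, θ j = θ' j) : comp F θ J = comp F θ' J := by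
  induction J with
  | zero => rfl
  | succ J ih =>
    funext Y
    simp only [comp]
    rw [h J (Nat.lt_succ_self J), ih fun j hj => h j (Nat.lt_succ_of_lt hj)]

variable [∀ j, NormedAddCommGroup (E j)]

theorem comp_norm_sub_le (F : ∀ j, w j → E j → E (j + 1)) (P : ∀ j, w j → Prop) (a : ℕ → ℝ)
    (ha : ∀ j, 0 ≤ a j) {J : ℕ}
    (hF : ∀ j < J, ∀ x, P j x → ∀ Y Y', ‖F j x Y - F j x Y'‖ ≤ a j * ‖Y - Y'‖)
    {θ : ∀ j, w j} (hθ : ∀ j < J, P j (θ j)) (Y Y' : E 0) :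
    ‖comp F θ J Y - comp F θ J Y'‖ ≤ (∏ j ∈ range J, a j) * ‖Y - Y'‖ := by
  induction J with
  | zero => simp [comp]
  | succ J ih =>
    have h1 := ih (fun j hj => hF j (Nat.lt_succ_of_lt hj)) fun j hj => hθ j (Nat.lt_succ_of_lt hj)
    have h2 := hF J (Nat.lt_succ_self J) _ (hθ J (Nat.lt_succ_self J)) (comp F θ J Y) (comp F θ J Y')
    refine h2.trans ((mul_le_mul_of_nonneg_left h1 (ha J)).trans (le_of_eq ?_))
    rw [prod_range_succ]
    ring

theorem comp_zero (F : ∀ j, w j → E j → E (j + 1)) (P : ∀ j, w j → Prop) {J : ℕ}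
    (hF : ∀ j < J, ∀ x, P j x → F j x 0 = 0) {θ : ∀ j, w j} (hθ : ∀ j < J, P j (θ j)) :
    comp F θ J 0 = 0 := by
  induction J with
  | zero => rfl
  | succ J ih =>
    simp only [comp]
    rw [ih (fun j hj => hF j (Nat.lt_succ_of_lt hj)) fun j hj => hθ j (Nat.lt_succ_of_lt hj)]
    exact hF J (Nat.lt_succ_self J) _ (hθ J (Nat.lt_succ_self J))

/-- Covers are relative to the norm of the input. Cover elements satisfy the constraints, so the
Lipschitz constants control the norm of the intermediate data at which the next stage is covered. -/
theorem HasCover.comp (F : ∀ j, w j → E j → E (j + 1)) (P : ∀ j, w j → Prop) (a e : ℕ → ℝ)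
    (N : ℕ → ℕ) (ha : ∀ j, 0 ≤ a j) {J : ℕ} (he : ∀ j < J, 0 ≤ e j)
    (hF : ∀ j < J, ∀ x, P j x → ∀ Y Y', ‖F j x Y - F j x Y'‖ ≤ a j * ‖Y - Y'‖)
    (hF0 : ∀ j < J, ∀ x, P j x → F j x 0 = 0)
    (hcov : ∀ j < J, HasCover (P j) (F j) (e j) (N j)) :
    HasCover (fun θ : ∀ j, w j => ∀ j < J, P j (θ j)) (fun θ => ResNet.comp F θ J)
      (∑ j ∈ range J, (∏ k ∈ (range J).erase j, a k) * e j) (∏ j ∈ range J, N j) := by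
  classical
  induction J with
  | zero =>
    intro Y
    by_cases h : Nonempty (∀ j, w j)
    · obtain ⟨θ⟩ := h
      exact ⟨{θ}, by simp, by simp, fun θ' _ => ⟨θ, by simp, by simp [ResNet.comp]⟩⟩
    · exact ⟨∅, by simp, by simp, fun θ => absurd ⟨θ⟩ h⟩
  | succ J ih =>
    intro Y
    have hlt : ∀ {j}, j < J → j < J + 1 := fun hj => Nat.lt_succ_of_lt hj
    have hJ := Nat.lt_succ_self J
    obtain ⟨U, hU1, hU2, hU3⟩ := ih (fun j hj => he j (hlt hj)) (fun j hj => hF j (hlt hj))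
      (fun j hj => hF0 j (hlt hj)) (fun j hj => hcov j (hlt hj)) Y
    -- The cover of the last stage depends on the data produced by the chosen earlier stages.
    choose V hV1 hV2 hV3 using fun θ => hcov J hJ (ResNet.comp F θ J Y)
    have hupd : ∀ (θ : ∀ j, w j) (x : w J), ∀ j < J, Function.update θ J x j = θ j :=
      fun θ x j hj => Function.update_of_ne hj.ne _ _
    refine ⟨U.biUnion fun θ => (V θ).image fun x => Function.update θ J x, ?_, ?_, ?_⟩
    · rw [prod_range_succ]
      exact (card_biUnion_le_card_mul _ _ (N J) fun θ _ => card_image_le.trans (hV1 θ)).trans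
        (Nat.mul_le_mul_right _ hU1)
    · intro θ hθ
      simp only [mem_biUnion, mem_image] at hθ
      obtain ⟨θ', hθ', x, hx, rfl⟩ := hθ
      intro j hj
      rcases Nat.lt_succ_iff_lt_or_eq.1 hj with h | rfl
      · rw [hupd _ _ _ h]
        exact hU2 _ hθ' j h
      · rw [Function.update_self]
        exact hV2 _ _ hx
    · intro θ hθ
      obtain ⟨θ', hθ', h1⟩ := hU3 θ fun j hj => hθ j (hlt hj)
      obtain ⟨x, hx, h2⟩ := hV3 θ' (θ J) (hθ J hJ)
      refine ⟨Function.update θ' J x,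
        mem_biUnion.2 ⟨θ', hθ', mem_image_of_mem (fun x => Function.update θ' J x) hx⟩, ?_⟩
      simp only [ResNet.comp, Function.update_self]
      rw [comp_congr F (hupd θ' x)]
      have h3 := hF J hJ _ (hθ J hJ) (ResNet.comp F θ J Y) (ResNet.comp F θ' J Y)
      have h4 : ‖ResNet.comp F θ' J Y‖ ≤ (∏ j ∈ range J, a j) * ‖Y‖ := by
        have := comp_norm_sub_le F P a ha (fun j hj => hF j (hlt hj)) (hU2 θ' hθ') Y 0
        rwa [comp_zero F P (fun j hj => hF0 j (hlt hj)) (hU2 θ' hθ'), sub_zero, sub_zero] at this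
      have hsum : ∑ j ∈ range (J + 1), (∏ k ∈ (range (J + 1)).erase j, a k) * e j
          = a J * (∑ j ∈ range J, (∏ k ∈ (range J).erase j, a k) * e j)
            + (∏ j ∈ range J, a j) * e J := by
        rw [sum_range_succ, mul_sum]
        congr 1
        · refine sum_congr rfl fun j hj => ?_
          have hj' : J ≠ j := (mem_range.1 hj).ne'
          rw [range_add_one, erase_insert_of_ne hj', prod_insert (by simp)]
          ring
        · rw [range_add_one, erase_insert (by simp)]
      rw [hsum]
      -- The intermediate point has the true last stage on the approximate input: old error is
      -- amplified by `a J`, new error is the covering error.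
      calc _ ≤ _ := norm_sub_le_norm_sub_add_norm_sub _ (F J (θ J) (ResNet.comp F θ' J Y)) _
        _ ≤ a J * ((∑ j ∈ range J, (∏ k ∈ (range J).erase j, a k) * e j) * ‖Y‖)
            + e J * ((∏ j ∈ range J, a j) * ‖Y‖) :=
          add_le_add (h3.trans (mul_le_mul_of_nonneg_left h1 (ha J)))
            (h2.trans (mul_le_mul_of_nonneg_left h4 (he J hJ)))
        _ = _ := by ring

end Composition

/-! ### Covers of residual networks -/

theorem lipschitzWith_lipConst {d m : ℕ} {f : Vec d → Vec m} (hf : ∃ K : ℝ≥0, LipschitzWith K f) :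
    LipschitzWith (lipConst f) f := by
  intro x y
  have hne : {K : ℝ≥0 | LipschitzWith K f}.Nonempty := hf
  rw [edist_nndist, edist_nndist, ← ENNReal.coe_mul, ENNReal.coe_le_coe]
  by_cases h : nndist x y = 0
  · obtain ⟨K, hK⟩ := hf
    have := hK.nndist_le x y
    rw [h, mul_zero] at this ⊢
    exact this
  · rw [← div_le_iff₀ (pos_iff_ne_zero.2 h)]
    refine le_csInf hne fun K hK => ?_
    rw [div_le_iff₀ (pos_iff_ne_zero.2 h)]
    exact hK.nndist_le x y

theorem coverRadius_nonneg (s : ℝ≥0) {b : ℝ} (hb : 0 ≤ b) (k : ℕ) : 0 ≤ coverRadius s b k := by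
  unfold coverRadius
  split_ifs <;> positivity

namespace Architecture

variable (A : Architecture)

theorem blockLip_nonneg (i : ℕ) : 0 ≤ A.blockLip i := by
  unfold blockLip
  positivity

/-- Layer `j` of block `i`, with its nonlinearity, acting on samples. -/
def stage (n i j : ℕ) (K : (A.layer i j).Weight) (Y : Sample n (A.dim i j)) :
    Sample n (A.dim i (j + 1)) :=
  mapSample (A.act i j) (mapSample ((A.layer i j).apply K) Y)

/-- Block `i`, with its nonlinearity, acting on samples. -/
def blockStage (n i : ℕ) (x : ∀ j, (A.layer i j).Weight) (Y : Sample n (A.dim i 0)) :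
    Sample n (A.dim (i + 1) 0) :=
  mapSample (A.actOut i) (mapSample (A.shortcut i) Y + comp (A.stage n i) x (A.depth i) Y)

theorem mapSample_inner {n : ℕ} (θ : A.Params) (i j : ℕ) (Y : Sample n (A.dim i 0)) :
    mapSample (A.inner θ i j) Y = comp (A.stage n i) (θ i) j Y := by
  induction j with
  | zero => rfl
  | succ j ih =>
    simp only [comp, ← ih]
    rfl

theorem mapSample_forward {n : ℕ} (θ : A.Params) (i : ℕ) (X : Sample n (A.dim 0 0)) :
    mapSample (A.forward θ i) X = comp (A.blockStage n) θ i X := by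
  induction i with
  | zero => rfl
  | succ i ih =>
    simp only [comp, ← ih, blockStage, ← mapSample_inner]
    rfl

/-- The constraints on the weights of a layer. -/
def LayerFeasible (i j : ℕ) (K : (A.layer i j).Weight) : Prop :=
  LipschitzWith (A.s i j) ((A.layer i j).apply K) ∧
    (A.layer i j).weightDist K (A.ref i j) ≤ A.b i j

/-- The constraints on the weights of a block. -/
def BlockFeasible (i : ℕ) (x : ∀ j, (A.layer i j).Weight) : Prop :=
  ∀ j < A.depth i, A.LayerFeasible i j (x j)

/-- The relative radius of the cover of block `i` obtained from sparsities `k`. -/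
noncomputable def blockRadius (k : ℕ → ℕ → ℕ) (i : ℕ) : ℝ :=
  ∑ j ∈ range (A.depth i), (∏ l ∈ (range (A.depth i)).erase j, (A.ρ i l : ℝ) * A.s i l) *
    (A.ρ i j * coverRadius (A.s i j) (A.b i j) (k i j))

/-- The relative radius of the cover of the network obtained from sparsities `k`. -/
noncomputable def netRadius (k : ℕ → ℕ → ℕ) : ℝ :=
  ∑ i ∈ range A.L, (∏ l ∈ (range A.L).erase i, A.blockLip l * A.ρOut l) *
    (A.ρOut i * A.blockRadius k i)

variable {A} (hA : A.Valid)
include hA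

theorem stage_norm_sub_le {n i : ℕ} (hi : i < A.L) {j : ℕ} (hj : j < A.depth i)
    {K : (A.layer i j).Weight} (hK : A.LayerFeasible i j K) (Y Y' : Sample n (A.dim i j)) :
    ‖A.stage n i j K Y - A.stage n i j K Y'‖ ≤ A.ρ i j * A.s i j * ‖Y - Y'‖ := by
  rw [mul_assoc]
  exact (mapSample_norm_sub_le (hA.act_lip i hi j hj) _ _).trans
    (mul_le_mul_of_nonneg_left (mapSample_norm_sub_le hK.1 _ _) (NNReal.coe_nonneg _))

theorem stage_zero {n i : ℕ} (hi : i < A.L) {j : ℕ} (hj : j < A.depth i)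
    (K : (A.layer i j).Weight) : A.stage n i j K 0 = 0 := by
  rw [stage, mapSample_zero (Layer.apply_zero _ K), mapSample_zero (hA.act_zero i hi j hj)]

theorem hasCover_stage {n i : ℕ} (hi : i < A.L) {j : ℕ} (hj : j < A.depth i) (k : ℕ) :
    HasCover (A.LayerFeasible i j) (A.stage n i j)
      (A.ρ i j * coverRadius (A.s i j) (A.b i j) k) (coverSize (A.numParams i j) k) := by
  intro Y
  obtain ⟨U, h1, h2, h3⟩ := (A.layer i j).exists_cover (A.ref i j) (A.s i j)
    (hA.b_pos i hi j hj).le k Y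
  refine ⟨U, h1, h2, fun K hK => ?_⟩
  obtain ⟨K', hK', hle⟩ := h3 K hK
  refine ⟨K', hK', (mapSample_norm_sub_le (hA.act_lip i hi j hj) _ _).trans ?_⟩
  rw [mul_assoc]
  exact mul_le_mul_of_nonneg_left hle (NNReal.coe_nonneg _)

theorem blockRadius_nonneg (k : ℕ → ℕ → ℕ) {i : ℕ} (hi : i < A.L) : 0 ≤ A.blockRadius k i :=
  sum_nonneg fun j hj => mul_nonneg (by positivity) (mul_nonneg (NNReal.coe_nonneg _)
    (coverRadius_nonneg _ (hA.b_pos i hi j (mem_range.1 hj)).le _))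

theorem hasCover_inner {n i : ℕ} (hi : i < A.L) (k : ℕ → ℕ → ℕ) :
    HasCover (A.BlockFeasible i) (fun x => comp (A.stage n i) x (A.depth i)) (A.blockRadius k i)
      (∏ j ∈ range (A.depth i), coverSize (A.numParams i j) (k i j)) :=
  HasCover.comp (A.stage n i) (A.LayerFeasible i) (fun j => (A.ρ i j : ℝ) * A.s i j) _ _
    (fun _ => by positivity)
    (fun j hj => mul_nonneg (NNReal.coe_nonneg _)
      (coverRadius_nonneg _ (hA.b_pos i hi j hj).le _))
    (fun _ hj _ hx => stage_norm_sub_le hA hi hj hx) (fun _ hj x _ => stage_zero hA hi hj x)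
    fun j hj => hasCover_stage hA hi hj (k i j)

theorem blockStage_norm_sub_le {n i : ℕ} (hi : i < A.L) {x : ∀ j, (A.layer i j).Weight}
    (hx : A.BlockFeasible i x) (Y Y' : Sample n (A.dim i 0)) :
    ‖A.blockStage n i x Y - A.blockStage n i x Y'‖ ≤ A.blockLip i * A.ρOut i * ‖Y - Y'‖ := by
  refine (mapSample_norm_sub_le (hA.actOut_lip i hi) _ _).trans ?_
  rw [mul_comm (A.blockLip i), mul_assoc, add_sub_add_comm, blockLip, add_mul]
  refine mul_le_mul_of_nonneg_left ((norm_add_le _ _).trans (add_le_add ?_ ?_))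
    (NNReal.coe_nonneg _)
  · exact mapSample_norm_sub_le (lipschitzWith_lipConst (hA.shortcut_lip i hi)) _ _
  · exact comp_norm_sub_le (A.stage n i) (A.LayerFeasible i) (fun j => (A.ρ i j : ℝ) * A.s i j)
      (fun _ => by positivity) (fun _ hj _ hx => stage_norm_sub_le hA hi hj hx) hx Y Y'

theorem blockStage_zero {n i : ℕ} (hi : i < A.L) {x : ∀ j, (A.layer i j).Weight}
    (hx : A.BlockFeasible i x) : A.blockStage n i x 0 = 0 := by
  rw [blockStage, mapSample_zero (hA.shortcut_zero i hi),
    comp_zero (A.stage n i) (A.LayerFeasible i) (fun _ hj x _ => stage_zero hA hi hj x) hx,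
    add_zero, mapSample_zero (hA.actOut_zero i hi)]

/-- The shortcut carries no weights and cancels in differences, so a cover of the residual branch
covers the block. -/
theorem hasCover_blockStage {n i : ℕ} (hi : i < A.L) (k : ℕ → ℕ → ℕ) :
    HasCover (A.BlockFeasible i) (A.blockStage n i) (A.ρOut i * A.blockRadius k i)
      (∏ j ∈ range (A.depth i), coverSize (A.numParams i j) (k i j)) := by
  intro Y
  obtain ⟨U, h1, h2, h3⟩ := hasCover_inner hA hi k Y
  refine ⟨U, h1, h2, fun x hx => ?_⟩
  obtain ⟨x', hx', hle⟩ := h3 x hx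
  refine ⟨x', hx', (mapSample_norm_sub_le (hA.actOut_lip i hi) _ _).trans ?_⟩
  rw [mul_assoc, add_sub_add_left_eq_sub]
  exact mul_le_mul_of_nonneg_left hle (NNReal.coe_nonneg _)

theorem hasCover_forward (n : ℕ) (k : ℕ → ℕ → ℕ) :
    HasCover A.Feasible (fun θ (X : Sample n (A.dim 0 0)) => mapSample (A.forward θ A.L) X)
      (A.netRadius k)
      (∏ i ∈ range A.L, ∏ j ∈ range (A.depth i), coverSize (A.numParams i j) (k i j)) := by
  have h := HasCover.comp (J := A.L) (A.blockStage n) A.BlockFeasible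
    (fun i => A.blockLip i * A.ρOut i)
    (fun i => A.ρOut i * A.blockRadius k i)
    (fun i => ∏ j ∈ range (A.depth i), coverSize (A.numParams i j) (k i j))
    (fun i => mul_nonneg (A.blockLip_nonneg i) (NNReal.coe_nonneg _))
    (fun i hi => mul_nonneg (NNReal.coe_nonneg _) (blockRadius_nonneg hA k hi))
    (fun i hi x hx => blockStage_norm_sub_le hA hi hx) (fun i hi x hx => blockStage_zero hA hi hx)
    fun i hi => hasCover_blockStage hA hi k
  simp only [mapSample_forward]
  exact h

/-- Cancels the quotients by `s_i` and `s_ij`, leaving the products over the other stages that occur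
in the cover radius. If `s_i = 0`, both of its summands vanish, and `s_ij > 0` makes the remaining
product zero too. -/
theorem C_eq {n : ℕ} (x : Fin n → Vec (A.dim 0 0)) {i : ℕ} (hi : i < A.L) {j : ℕ}
    (hj : j < A.depth i) :
    A.C x i j = 2 * (dataNorm x / √(n : ℝ)) *
      ((∏ l ∈ (range A.L).erase i, A.blockLip l * A.ρOut l) * A.ρOut i) *
      ((∏ l ∈ (range (A.depth i)).erase j, (A.ρ i l : ℝ) * A.s i l) * A.ρ i j) * A.b i j := by
  have hs : (A.s i j : ℝ) ≠ 0 := by exact_mod_cast (hA.s_pos i hi j hj).ne'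
  have h1 := mul_prod_erase (range A.L) (fun l => A.blockLip l * A.ρOut l) (mem_range.2 hi)
  have h2 := mul_prod_erase (range (A.depth i)) (fun l => (A.ρ i l : ℝ) * A.s i l) (mem_range.2 hj)
  have h3 : ∏ l ∈ range (A.depth i), (A.s i l : ℝ) * A.ρ i l
      = ∏ l ∈ range (A.depth i), (A.ρ i l : ℝ) * A.s i l :=
    prod_congr rfl fun _ _ => mul_comm _ _
  rw [C, h3, ← h1, ← h2]
  set Q := ∏ l ∈ (range (A.depth i)).erase j, (A.ρ i l : ℝ) * A.s i l with hQ
  by_cases h0 : A.blockLip i = 0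
  · have hz : (A.ρ i j : ℝ) * A.s i j * Q = 0 := by
      rw [h2]
      have hn : 0 ≤ ∏ l ∈ range (A.depth i), (A.ρ i l : ℝ) * A.s i l :=
        prod_nonneg fun _ _ => by positivity
      have hn' : (0 : ℝ) ≤ lipConst (A.shortcut i) := NNReal.coe_nonneg _
      rw [blockLip] at h0
      linarith
    have hz' : Q * (A.ρ i j : ℝ) = 0 := by
      have : (A.s i j : ℝ) * (Q * A.ρ i j) = 0 := by rw [← hz]; ring
      exact (mul_eq_zero.1 this).resolve_left hs
    rw [hz, hz']
    ring
  · field_simp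

theorem C_nonneg {n : ℕ} (x : Fin n → Vec (A.dim 0 0)) {i : ℕ} (hi : i < A.L) {j : ℕ}
    (hj : j < A.depth i) : 0 ≤ A.C x i j := by
  rw [C_eq hA x hi hj]
  have h1 := (hA.b_pos i hi j hj).le
  have h2 : 0 ≤ ∏ l ∈ (range A.L).erase i, A.blockLip l * A.ρOut l :=
    prod_nonneg fun l _ => mul_nonneg (A.blockLip_nonneg l) (NNReal.coe_nonneg _)
  have h3 : 0 ≤ dataNorm x := Real.sqrt_nonneg _
  positivity

theorem Ctilde_nonneg {n : ℕ} (x : Fin n → Vec (A.dim 0 0)) {γ : ℝ} (hγ : 0 < γ) {i : ℕ}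
    (hi : i < A.L) {j : ℕ} (hj : j < A.depth i) : 0 ≤ A.Ctilde γ x i j :=
  div_nonneg (mul_nonneg zero_le_two (C_nonneg hA x hi hj)) hγ.le

theorem netRadius_mul_le {n : ℕ} (hn : 0 < n) (x : Fin n → Vec (A.dim 0 0)) {γ : ℝ} (hγ : 0 < γ)
    (k : ℕ → ℕ → ℕ) (hk : ∀ i < A.L, ∀ j < A.depth i, k i j = 0 → A.Ctilde γ x i j = 0) :
    2 / γ * (A.netRadius k * dataNorm x) ≤
      √(n : ℝ) * ∑ i ∈ range A.L, ∑ j ∈ range (A.depth i), A.Ctilde γ x i j / √(k i j : ℝ) := by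
  have hnR : (0 : ℝ) < √(n : ℝ) := Real.sqrt_pos.2 (by exact_mod_cast hn)
  simp only [netRadius, blockRadius, mul_sum, sum_mul]
  refine sum_le_sum fun i hi' => sum_le_sum fun j hj' => ?_
  have hi := mem_range.1 hi'
  have hj := mem_range.1 hj'
  have hC := C_eq hA x hi hj
  set P := ∏ l ∈ (range A.L).erase i, A.blockLip l * A.ρOut l
  set Q := ∏ l ∈ (range (A.depth i)).erase j, (A.ρ i l : ℝ) * A.s i l
  -- Here `C_ij = 0`; since `b_ij > 0`, the factors multiplying the trivial radius `2 s_ij` vanish.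
  by_cases h0 : k i j = 0
  · have hz : A.C x i j = 0 := by
      have := hk i hi j hj h0
      rw [Ctilde, div_eq_zero_iff] at this
      rcases this with h | h
      · linarith
      · exact absurd h hγ.ne'
    have hb := (hA.b_pos i hi j hj).ne'
    have : (P * A.ρOut i) * (Q * A.ρ i j) * dataNorm x = 0 := by
      have e : (2 * A.b i j / √(n : ℝ)) * ((P * A.ρOut i) * (Q * A.ρ i j) * dataNorm x) = 0 := by
        rw [← hz, hC]; ring
      exact (mul_eq_zero.1 e).resolve_left (by positivity)
    rw [hk i hi j hj h0]
    refine le_of_eq ?_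
    calc _ = 2 / γ * coverRadius (A.s i j) (A.b i j) (k i j) *
          ((P * A.ρOut i) * (Q * A.ρ i j) * dataNorm x) := by ring
      _ = _ := by rw [this]; simp
  · have hk0 : (0 : ℝ) < √(k i j : ℝ) :=
      Real.sqrt_pos.2 (by exact_mod_cast Nat.pos_of_ne_zero h0)
    refine le_of_eq ?_
    rw [Ctilde, hC, coverRadius, if_neg h0]
    field_simp

end Architecture

/-! ### The loss -/

theorem rampLoss_eq {γ : ℝ} (hγ : 0 < γ) (r : ℝ) : rampLoss γ r = max 0 (min 1 (1 + r / γ)) := by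
  unfold rampLoss
  split_ifs with h1 h2
  · have : 0 < r / γ := by positivity
    rw [min_eq_left (by linarith), max_eq_right zero_le_one]
  · have h3 : r / γ ≤ 0 := div_nonpos_of_nonpos_of_nonneg (not_lt.1 h1) hγ.le
    have h4 : -1 ≤ r / γ := by rw [le_div_iff₀ hγ]; linarith
    rw [min_eq_right (by linarith), max_eq_right (by linarith)]
  · have h4 : r / γ ≤ -1 := by rw [div_le_iff₀ hγ]; linarith
    rw [max_eq_left]
    exact (min_le_right _ _).trans (by linarith)

theorem rampLoss_mem_Icc {γ : ℝ} (hγ : 0 < γ) (r : ℝ) : rampLoss γ r ∈ Set.Icc (0 : ℝ) 1 := by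
  rw [rampLoss_eq hγ]
  exact ⟨le_max_left _ _, max_le zero_le_one (min_le_left _ _)⟩

theorem abs_rampLoss_sub_le {γ : ℝ} (hγ : 0 < γ) (r t : ℝ) :
    |rampLoss γ r - rampLoss γ t| ≤ |r - t| / γ := by
  rw [rampLoss_eq hγ, rampLoss_eq hγ]
  calc _ ≤ |min 1 (1 + r / γ) - min 1 (1 + t / γ)| := by
        simpa [max_comm] using abs_max_sub_max_le_abs (min 1 (1 + r / γ)) (min 1 (1 + t / γ)) 0
    _ ≤ |(1 + r / γ) - (1 + t / γ)| := by
        simpa using abs_min_sub_min_le_max 1 (1 + r / γ) 1 (1 + t / γ)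
    _ = |r - t| / γ := by
        rw [add_sub_add_left_eq_sub, ← sub_div, abs_div, abs_of_pos hγ]

/-- The true score and the maximum of the others each move by at most `‖v - v'‖`. Two classes make
the supremum range over a nonempty set. -/
theorem abs_margin_sub_le {κ : ℕ} (hκ : 2 ≤ κ) (v v' : Vec κ) (y : Fin κ) :
    |margin v y - margin v' y| ≤ 2 * ‖v - v'‖ := by
  have : Nontrivial (Fin κ) := Fin.nontrivial_iff_two_le.2 hκ
  obtain ⟨i₀, hi₀⟩ := exists_ne y
  have : Nonempty {i : Fin κ // i ≠ y} := ⟨⟨i₀, hi₀⟩⟩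
  have hc : ∀ i, |v i - v' i| ≤ ‖v - v'‖ := fun i => by
    simpa using PiLp.norm_apply_le (v - v') i
  have hsup : ∀ a b : Vec κ, (∀ i, |a i - b i| ≤ ‖v - v'‖) →
      (⨆ i : {i : Fin κ // i ≠ y}, a i) ≤ (⨆ i : {i : Fin κ // i ≠ y}, b i) + ‖v - v'‖ := by
    intro a b hab
    refine ciSup_le fun i => ?_
    have h1 := le_ciSup (f := fun i : {i : Fin κ // i ≠ y} => b i) (Set.finite_range _).bddAbove i
    have h2 := (abs_le.1 (hab i)).2
    simp only at h1
    linarith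
  have h1 := hsup v v' hc
  have h2 := hsup v' v fun i => by rw [abs_sub_comm]; exact hc i
  have h3 := abs_le.1 (hc y)
  unfold margin
  rw [abs_le]
  constructor <;> linarith [h3.1, h3.2]

theorem norm_ramp_sub_le {n κ : ℕ} (hκ : 2 ≤ κ) {γ : ℝ} (hγ : 0 < γ) (Y Y' : Sample n κ)
    (y : Fin n → Fin κ) :
    ‖(WithLp.toLp 2 fun k => rampLoss γ (-margin (Y k) (y k)) : Vec n) -
      WithLp.toLp 2 fun k => rampLoss γ (-margin (Y' k) (y k))‖ ≤ 2 / γ * ‖Y - Y'‖ := by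
  refine abs_le_of_sq_le_sq' ?_ (by positivity) |>.2
  rw [mul_pow, PiLp.norm_sq_eq_of_L2, PiLp.norm_sq_eq_of_L2, mul_sum]
  refine sum_le_sum fun k _ => ?_
  rw [← mul_pow]
  refine pow_le_pow_left₀ (norm_nonneg _) ?_ 2
  simp only [PiLp.sub_apply, Real.norm_eq_abs]
  refine (abs_rampLoss_sub_le hγ _ _).trans ?_
  rw [div_mul_eq_mul_div]
  gcongr
  rw [neg_sub_neg, abs_sub_comm]
  exact abs_margin_sub_le hκ _ _ _

namespace Architecture

theorem exists_cover_rampClass {A : Architecture} (hA : A.Valid) (hκ : 2 ≤ A.dim A.L 0) {n : ℕ}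
    (hn : 0 < n) (S : Fin n → Vec (A.dim 0 0) × Fin (A.dim A.L 0)) {γ : ℝ} (hγ : 0 < γ)
    (k : ℕ → ℕ → ℕ)
    (hk : ∀ i < A.L, ∀ j < A.depth i, k i j = 0 → A.Ctilde γ (fun k => (S k).1) i j = 0) {δ : ℝ}
    (hδ : ∑ i ∈ range A.L, ∑ j ∈ range (A.depth i),
      A.Ctilde γ (fun k => (S k).1) i j / √(k i j : ℝ) ≤ δ) :
    ∃ T : Finset (Vec n),
      Real.log T.card ≤ ∑ i ∈ range A.L, ∑ j ∈ range (A.depth i),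
        Real.log (coverSize (A.numParams i j) (k i j)) ∧
      ∀ h ∈ rampClass γ A.netClass, ∃ t ∈ T,
        ‖WithLp.toLp 2 (fun k => h (S k)) - t‖ ≤ √(n : ℝ) * δ := by
  classical
  set x : Fin n → Vec (A.dim 0 0) := fun k => (S k).1 with hx
  set X : Sample n (A.dim 0 0) := WithLp.toLp 2 x with hX
  have hXn : ‖X‖ = dataNorm x := PiLp.norm_eq_of_L2 _
  obtain ⟨U, h1, h2, h3⟩ := hasCover_forward hA n k X
  set ev : A.Params → Vec n := fun θ =>
    WithLp.toLp 2 fun k => rampLoss γ (-margin (A.forward θ A.L (S k).1) (S k).2) with hev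
  refine ⟨U.image ev, ?_, ?_⟩
  · rcases Nat.eq_zero_or_pos (U.image ev).card with h0 | h0
    · rw [h0, Nat.cast_zero, Real.log_zero]
      exact sum_nonneg fun _ _ => sum_nonneg fun _ _ => Real.log_natCast_nonneg _
    · have hle := Real.log_le_log (by exact_mod_cast h0)
        (Nat.cast_le (α := ℝ).2 (card_image_le.trans h1))
      refine hle.trans (le_of_eq ?_)
      have hne : ∀ W k, (coverSize W k : ℝ) ≠ 0 := fun W k => by
        exact_mod_cast (coverSize_pos W k).ne'
      push_cast
      rw [Real.log_prod fun i _ => prod_ne_zero_iff.2 fun j _ => hne _ _]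
      exact sum_congr rfl fun i _ => Real.log_prod fun j _ => hne _ _
  · rintro _ ⟨_, ⟨θ, hθ, rfl⟩, rfl⟩
    obtain ⟨θ', hθ', hle⟩ := h3 θ hθ
    refine ⟨ev θ', mem_image_of_mem _ hθ', ?_⟩
    refine (norm_ramp_sub_le hκ hγ (mapSample (A.forward θ A.L) X)
      (mapSample (A.forward θ' A.L) X) fun k => (S k).2).trans ?_
    rw [hXn] at hle
    exact (mul_le_mul_of_nonneg_left hle (by positivity)).trans
      ((netRadius_mul_le hA hn x hγ k hk).trans
        (mul_le_mul_of_nonneg_left hδ (Real.sqrt_nonneg _)))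

end Architecture

/-! ### The function `ψ` -/

theorem summable_hurwitz {q : ℝ} (hq : 1 ≤ q) :
    Summable fun k : ℕ => 1 / (q + k) ^ (3 / 2 : ℝ) := by
  have h := (Real.summable_one_div_nat_add_rpow q (3 / 2)).2 (by norm_num)
  refine h.congr fun k => ?_
  rw [abs_of_nonneg (by positivity), add_comm]

theorem hurwitz_strictAnti {q q' : ℝ} (hq : 1 ≤ q) (h : q < q') :
    hurwitz (3 / 2) q' < hurwitz (3 / 2) q := by
  have hlt : ∀ k : ℕ, 1 / (q' + k) ^ (3 / 2 : ℝ) < 1 / (q + k) ^ (3 / 2 : ℝ) := fun k =>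
    one_div_lt_one_div_of_lt (by positivity)
      (Real.rpow_lt_rpow (by positivity) (by linarith) (by norm_num))
  exact Summable.tsum_lt_tsum (i := 0) (fun k => (hlt k).le) (hlt 0)
    (summable_hurwitz (hq.trans h.le)) (summable_hurwitz hq)

theorem le_hurwitz {q : ℝ} (hq : 1 ≤ q) : 1 / q ^ (3 / 2 : ℝ) ≤ hurwitz (3 / 2) q := by
  have := (summable_hurwitz hq).le_tsum 0 fun k _ => by positivity
  simpa [hurwitz] using this

theorem hurwitz_pos {q : ℝ} (hq : 1 ≤ q) : 0 < hurwitz (3 / 2) q :=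
  lt_of_lt_of_le (by positivity) (le_hurwitz hq)

theorem one_le_hurwitz_one : 1 ≤ hurwitz (3 / 2) 1 := by
  simpa using le_hurwitz le_rfl

theorem rpow_three_halves {x : ℝ} (hx : 0 ≤ x) : x ^ (3 / 2 : ℝ) = x * √x := by
  rw [show (3 / 2 : ℝ) = 1 + 1 / 2 by norm_num, Real.rpow_add' hx (by norm_num), Real.rpow_one,
    Real.sqrt_eq_rpow]

/-- The right side is the integral of the decreasing function `x^(-3/2)` over `[m, m + 1]`. -/
theorem one_div_add_one_rpow_le {m : ℝ} (hm : 0 < m) :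
    1 / (m + 1) ^ (3 / 2 : ℝ) ≤ 2 / √m - 2 / √(m + 1) := by
  rw [rpow_three_halves (by positivity)]
  have ha : 0 < √m := Real.sqrt_pos.2 hm
  have hb : 0 < √(m + 1) := Real.sqrt_pos.2 (by positivity)
  have hab : √m ≤ √(m + 1) := Real.sqrt_le_sqrt (by linarith)
  have ha2 : √m ^ 2 = m := Real.sq_sqrt hm.le
  have hb2 : √(m + 1) ^ 2 = m + 1 := Real.sq_sqrt (by positivity)
  set a := √m
  set b := √(m + 1)
  rw [← hb2, div_sub_div _ _ ha.ne' hb.ne', div_le_div_iff₀ (by positivity) (by positivity)]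
  have h1 : (b - a) * (b + a) = 1 := by nlinarith
  have h2 : a * (b + a) ≤ 2 * b ^ 2 := by nlinarith
  have h3 : 0 ≤ b - a := by linarith
  nlinarith [mul_nonneg (mul_nonneg h3 hb.le) (sub_nonneg.2 h2)]

theorem hurwitz_one_lt : hurwitz (3 / 2) 1 < 2.7 := by
  -- Four explicit terms sum to about `1.672`; the telescoping tail contributes at most `2/√4 = 1`.
  have hpart : ∀ N : ℕ, ∑ k ∈ range (N + 4), 1 / (1 + (k : ℝ)) ^ (3 / 2 : ℝ)
      ≤ 2.68 - 2 / √((N : ℝ) + 4) := by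
    intro N
    induction N with
    | zero =>
      have h2 : (1.414 : ℝ) ≤ √2 := Real.le_sqrt_of_sq_le (by norm_num)
      have h3 : (1.73 : ℝ) ≤ √3 := Real.le_sqrt_of_sq_le (by norm_num)
      have h4 : √4 = (2 : ℝ) := by
        rw [show (4 : ℝ) = 2 ^ 2 by norm_num, Real.sqrt_sq (by norm_num)]
      simp only [zero_add, sum_range_succ, sum_range_zero, Nat.cast_zero, Nat.cast_one,
        Nat.cast_ofNat, add_zero, Real.one_rpow]
      rw [show (1 + 1 : ℝ) = 2 by norm_num, show (1 + 2 : ℝ) = 3 by norm_num,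
        show (1 + 3 : ℝ) = 4 by norm_num, rpow_three_halves zero_le_two,
        rpow_three_halves zero_le_three, rpow_three_halves zero_le_four, h4]
      have e2 : 1 / (2 * √2) ≤ (1 / (2 * 1.414) : ℝ) := by gcongr
      have e3 : 1 / (3 * √3) ≤ (1 / (3 * 1.73) : ℝ) := by gcongr
      norm_num at e2 e3 ⊢
      linarith
    | succ N ih =>
      rw [show N + 1 + 4 = (N + 4) + 1 by ring, sum_range_succ]
      have h := one_div_add_one_rpow_le (m := (N : ℝ) + 4) (by positivity)
      push_cast
      rw [show (1 : ℝ) + (N + 4) = N + 4 + 1 by ring, show (N : ℝ) + 1 + 4 = N + 4 + 1 by ring]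
      linarith
  have hle : hurwitz (3 / 2) 1 ≤ 2.68 := by
    refine Real.tsum_le_of_sum_range_le (fun _ => by positivity) fun N => ?_
    calc _ ≤ ∑ k ∈ range (N + 4), 1 / (1 + (k : ℝ)) ^ (3 / 2 : ℝ) :=
          sum_le_sum_of_subset_of_nonneg (range_mono (by omega)) fun _ _ _ => by positivity
      _ ≤ 2.68 - 2 / √((N : ℝ) + 4) := hpart N
      _ ≤ 2.68 := sub_le_self _ (by positivity)
  exact hle.trans_lt (by norm_num)

theorem psi_zero : psi 0 = 0 := by
  simp [psi]

theorem psi_of_pos {x : ℝ} (hx : 0 < x) :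
    psi x = hurwitz (3 / 2) 1 ^ (1 / 3 : ℝ) * hurwitz (3 / 2) (1 + 1 / x) ^ (2 / 3 : ℝ) := by
  rw [psi, if_pos hx]

theorem one_le_one_add_one_div {x : ℝ} (hx : 0 < x) : 1 ≤ 1 + 1 / x := by
  have : 0 < 1 / x := by positivity
  linarith

theorem psi_pos {x : ℝ} (hx : 0 < x) : 0 < psi x := by
  rw [psi_of_pos hx]
  exact mul_pos (Real.rpow_pos_of_pos (hurwitz_pos le_rfl) _)
    (Real.rpow_pos_of_pos (hurwitz_pos (one_le_one_add_one_div hx)) _)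

theorem strictMonoOn_psi : StrictMonoOn psi (Set.Ici 0) := by
  intro x hx y _ hxy
  rcases (Set.mem_Ici.1 hx).eq_or_lt with rfl | hx0
  · rw [psi_zero]
    exact psi_pos hxy
  · rw [psi_of_pos hx0, psi_of_pos (hx0.trans hxy)]
    refine mul_lt_mul_of_pos_left (Real.rpow_lt_rpow (hurwitz_pos (one_le_one_add_one_div hx0)).le
      (hurwitz_strictAnti (one_le_one_add_one_div (hx0.trans hxy)) ?_) (by norm_num))
      (Real.rpow_pos_of_pos (hurwitz_pos le_rfl) _)
    have := one_div_lt_one_div_of_lt hx0 hxy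
    linarith

theorem psi_lt {x : ℝ} (hx : 0 ≤ x) : psi x < 2.7 := by
  rcases hx.eq_or_lt with rfl | hx0
  · rw [psi_zero]
    norm_num
  · refine lt_of_le_of_lt ?_ hurwitz_one_lt
    have h1 := hurwitz_pos (le_refl (1 : ℝ))
    rw [psi_of_pos hx0]
    calc _ ≤ hurwitz (3 / 2) 1 ^ (1 / 3 : ℝ) * hurwitz (3 / 2) 1 ^ (2 / 3 : ℝ) := by
          refine mul_le_mul_of_nonneg_left (Real.rpow_le_rpow
            (hurwitz_pos (one_le_one_add_one_div hx0)).le (hurwitz_strictAnti le_rfl ?_).le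
            (by norm_num)) (by positivity)
          have : 0 < 1 / x := by positivity
          linarith
      _ = hurwitz (3 / 2) 1 := by
          rw [← Real.rpow_add h1]
          norm_num

/-- The first term of the second zeta series is at least `2^(-3/2)`, whose `2/3` power is `1/2`; the
other factor is at least 1. -/
theorem half_le_psi {x : ℝ} (hx : 1 ≤ x) : 1 / 2 ≤ psi x := by
  have hx0 : 0 < x := by linarith
  have hq : 1 + 1 / x ≤ 2 := by
    have := div_le_one_of_le₀ hx hx0.le
    linarith
  have h1 : 1 / (2 : ℝ) ^ (3 / 2 : ℝ) ≤ hurwitz (3 / 2) (1 + 1 / x) := by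
    refine le_trans ?_ (le_hurwitz (one_le_one_add_one_div hx0))
    gcongr
  have h2 : (1 / 2 : ℝ) = (1 / (2 : ℝ) ^ (3 / 2 : ℝ)) ^ (2 / 3 : ℝ) := by
    rw [Real.div_rpow zero_le_one (by positivity), ← Real.rpow_mul zero_le_two, Real.one_rpow]
    norm_num
  rw [psi_of_pos hx0, h2, ← one_mul ((1 / (2 : ℝ) ^ (3 / 2 : ℝ)) ^ (2 / 3 : ℝ))]
  exact mul_le_mul (Real.one_le_rpow one_le_hurwitz_one (by norm_num))
    (Real.rpow_le_rpow (by positivity) h1 (by norm_num)) (by positivity) (by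
      have := hurwitz_pos (le_refl (1 : ℝ)); positivity)

theorem harmonic_isBigO_log :
    (fun n : ℕ => (harmonic (n - 1) : ℝ)) =O[Filter.atTop] fun n : ℕ => Real.log (n : ℝ) := by
  refine Asymptotics.IsBigO.of_bound 2 ?_
  filter_upwards [Filter.eventually_ge_atTop 3] with n hn
  have h1 : (0 : ℝ) ≤ harmonic (n - 1) := by
    rw [harmonic]
    push_cast
    positivity
  have h2 : 1 ≤ Real.log n := by
    rw [Real.le_log_iff_exp_le (by positivity)]
    have : (3 : ℝ) ≤ n := by exact_mod_cast hn
    linarith [Real.exp_one_lt_d9]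
  rw [Real.norm_of_nonneg h1, Real.norm_of_nonneg (by linarith)]
  have h3 : Real.log ((n - 1 : ℕ) : ℝ) ≤ Real.log n := by
    apply Real.log_le_log
    · exact_mod_cast (by omega : 0 < n - 1)
    · exact_mod_cast Nat.sub_le n 1
  linarith [harmonic_le_one_add_log (n - 1)]

/-! ### The two bounds -/

theorem half_pow_mul_sqrt (j : ℕ) {t : ℝ} :
    (1 / 2 : ℝ) ^ j * √(4 ^ j * t) = √t := by
  have h : √((4 : ℝ) ^ j) = 2 ^ j := by
    rw [show (4 : ℝ) ^ j = (2 ^ j) ^ 2 by rw [← pow_mul, mul_comm, pow_mul]; norm_num,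
      Real.sqrt_sq (by positivity)]
  rw [Real.sqrt_mul (by positivity), h, ← mul_assoc, ← mul_pow]
  norm_num

/-- Combines `log n ≤ H_{n-1}` with `log 2 > 1/2`. -/
theorem log_le_two_mul_harmonic {n : ℕ} (hn : 0 < n) :
    (Nat.log 2 n : ℝ) ≤ 2 * (harmonic (n - 1) : ℝ) := by
  have h1 := log_add_one_le_harmonic (n - 1)
  rw [Nat.sub_add_cancel hn] at h1
  have h2 : (Nat.log 2 n : ℝ) * Real.log 2 ≤ Real.log n := by
    rw [← Real.log_pow]
    refine Real.log_le_log (by positivity) ?_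
    exact_mod_cast Nat.pow_log_le_self 2 hn.ne'
  have h3 := Real.log_two_gt_d9
  have h4 : (0 : ℝ) ≤ Nat.log 2 n := Nat.cast_nonneg _
  nlinarith

theorem half_pow_log_le {n : ℕ} (hn : 0 < n) : (1 / 2 : ℝ) ^ Nat.log 2 n ≤ 4 / n := by
  have h : (n : ℝ) ≤ 2 ^ (Nat.log 2 n + 1) := by
    exact_mod_cast (Nat.lt_pow_succ_log_self one_lt_two n).le
  have hn' : (0 : ℝ) < n := by exact_mod_cast hn
  rw [one_div, inv_pow, inv_eq_one_div, div_le_div_iff₀ (by positivity) hn']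
  rw [pow_succ] at h
  linarith

theorem sum_mul_half_pow_le (N : ℕ) : ∑ j ∈ range N, (1 / 2 : ℝ) ^ (j + 1) * (j + 1) ≤ 2 := by
  have h : ∑ j ∈ range N, (1 / 2 : ℝ) ^ (j + 1) * (j + 1) = 2 - (N + 2) * (1 / 2) ^ N := by
    induction N with
    | zero => simp
    | succ N ih =>
      rw [sum_range_succ, ih, pow_succ]
      push_cast
      ring
  rw [h]
  exact sub_le_self _ (by positivity)

theorem sum_half_pow_le (N : ℕ) : ∑ j ∈ range N, (1 / 2 : ℝ) ^ (j + 1) ≤ 1 := by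
  have h : ∑ j ∈ range N, (1 / 2 : ℝ) ^ (j + 1) = 1 - (1 / 2) ^ N := by
    induction N with
    | zero => simp
    | succ N ih =>
      rw [sum_range_succ, ih, pow_succ]
      ring
  rw [h]
  exact sub_le_self _ (by positivity)

theorem sum_half_pow_mul_log_le (a N : ℕ) :
    ∑ j ∈ range N, (1 / 2 : ℝ) ^ (j + 1) * Real.log (1 + (a * 4 ^ (j + 1) : ℕ))
      ≤ 4 * (Real.log (1 + a) + psi a) := by
  rcases Nat.eq_zero_or_pos a with rfl | ha
  · simp [psi_zero]
  have ha' : (1 : ℝ) ≤ a := by exact_mod_cast ha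
  have hlog : ∀ j : ℕ, Real.log (1 + (a * 4 ^ (j + 1) : ℕ))
      ≤ Real.log (1 + a) + (j + 1) * (2 * Real.log 2) := by
    intro j
    have e : ((j : ℝ) + 1) * (2 * Real.log 2) = Real.log (4 ^ (j + 1)) := by
      rw [Real.log_pow, show (4 : ℝ) = 2 ^ 2 by norm_num, Real.log_pow]
      push_cast
      ring
    rw [e, ← Real.log_mul (by positivity) (by positivity)]
    refine Real.log_le_log (by positivity) ?_
    push_cast
    have : (1 : ℝ) ≤ 4 ^ (j + 1) := one_le_pow₀ (by norm_num)
    nlinarith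
  have h0 : 0 ≤ Real.log (1 + a) := Real.log_nonneg (by linarith)
  have hl : Real.log 2 ≤ Real.log (1 + a) := Real.log_le_log (by norm_num) (by linarith)
  have hl2 := Real.log_two_gt_d9
  have hl3 := Real.log_two_lt_d9
  calc _ ≤ ∑ j ∈ range N, (1 / 2 : ℝ) ^ (j + 1) * (Real.log (1 + a) + (j + 1) * (2 * Real.log 2)) := by
        refine sum_le_sum fun j _ => mul_le_mul_of_nonneg_left (hlog j) (by positivity)
    _ = (∑ j ∈ range N, (1 / 2 : ℝ) ^ (j + 1)) * Real.log (1 + a)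
        + (∑ j ∈ range N, (1 / 2 : ℝ) ^ (j + 1) * (j + 1)) * (2 * Real.log 2) := by
        rw [sum_mul, sum_mul, ← sum_add_distrib]
        exact sum_congr rfl fun j _ => by ring
    _ ≤ 1 * Real.log (1 + a) + 2 * (2 * Real.log 2) := by
        gcongr
        · exact sum_half_pow_le N
        · exact sum_mul_half_pow_le N
    -- Of `4 log 2`, three parts go into `3 log (1 + a)` and the last into `4 psi a ≥ 2`.
    _ ≤ _ := by linarith [half_le_psi ha']

/-- Concavity of the square root, as Cauchy-Schwarz with weights of total mass at most 1. -/
theorem sum_half_pow_mul_sqrt_le (Λ : ℕ → ℝ) (hΛ : ∀ j, 0 ≤ Λ j) (N : ℕ) :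
    ∑ j ∈ range N, (1 / 2 : ℝ) ^ (j + 1) * √(Λ j) ≤ √(∑ j ∈ range N, (1 / 2 : ℝ) ^ (j + 1) * Λ j) := by
  have h := Real.sum_sqrt_mul_sqrt_le (range N) (f := fun j => (1 / 2 : ℝ) ^ (j + 1))
    (g := fun j => (1 / 2 : ℝ) ^ (j + 1) * Λ j) (fun j => by positivity)
    fun j => mul_nonneg (by positivity) (hΛ j)
  calc _ = ∑ j ∈ range N, √((1 / 2 : ℝ) ^ (j + 1)) * √((1 / 2 : ℝ) ^ (j + 1) * Λ j) := by
        refine sum_congr rfl fun j _ => ?_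
        rw [Real.sqrt_mul (by positivity), ← mul_assoc, Real.mul_self_sqrt (by positivity)]
    _ ≤ _ := h
    _ ≤ _ := mul_le_of_le_one_left (Real.sqrt_nonneg _)
        (Real.sqrt_le_one.2 (sum_half_pow_le N))

namespace Architecture

variable {A : Architecture}

theorem numParams_le_maxParams {i : ℕ} (hi : i < A.L) {j : ℕ} (hj : j < A.depth i) :
    A.numParams i j ≤ A.maxParams :=
  (le_sup (f := fun j => A.numParams i j) (mem_range.2 hj)).trans
    (le_sup (f := fun i => (range (A.depth i)).sup fun j => A.numParams i j) (mem_range.2 hi))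

theorem log_two_mul_numParams_le {i : ℕ} (hi : i < A.L) {j : ℕ} (hj : j < A.depth i) :
    Real.log (2 * A.numParams i j) ≤ Real.log (2 * A.maxParams) := by
  have h := numParams_le_maxParams hi hj
  rcases Nat.eq_zero_or_pos (A.numParams i j) with h0 | h0
  · rw [h0, Nat.cast_zero, mul_zero, Real.log_zero]
    exact_mod_cast Real.log_natCast_nonneg (2 * A.maxParams)
  · have h0' : (0 : ℝ) < A.numParams i j := by exact_mod_cast h0
    have h' : (A.numParams i j : ℝ) ≤ A.maxParams := by exact_mod_cast h
    exact Real.log_le_log (by positivity) (by linarith)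

theorem rademacher_le_of_sparsities (hA : A.Valid) (hκ : 2 ≤ A.dim A.L 0) {n : ℕ} (hn : 0 < n)
    (S : Fin n → Vec (A.dim 0 0) × Fin (A.dim A.L 0)) {γ : ℝ} (hγ : 0 < γ) (k : ℕ → ℕ → ℕ → ℕ)
    (hk : ∀ l, ∀ i < A.L, ∀ j < A.depth i, k l i j = 0 → A.Ctilde γ (fun k => (S k).1) i j = 0)
    (hδ : ∀ l, ∑ i ∈ range A.L, ∑ j ∈ range (A.depth i),
      A.Ctilde γ (fun k => (S k).1) i j / √(k l i j : ℝ) ≤ (1 / 2) ^ l)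
    (Λ : ℕ → ℝ) (hΛ : Monotone Λ) (hΛ0 : 0 ≤ Λ 0)
    (hcard : ∀ l, ∑ i ∈ range A.L, ∑ j ∈ range (A.depth i),
      Real.log (coverSize (A.numParams i j) (k l i j)) ≤ Λ l) (N : ℕ) :
    rademacher S (rampClass γ A.netClass) ≤
      (1 / 2) ^ N + 6 / √(n : ℝ) * ∑ j ∈ range N, (1 / 2) ^ (j + 1) * √(Λ (j + 1)) := by
  refine rademacher_le hn S _ ?_ Λ hΛ hΛ0 (fun l => ?_) N
  · rintro _ ⟨f, -, rfl⟩ z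
    exact rampLoss_mem_Icc hγ _
  · obtain ⟨T, h1, h2⟩ := exists_cover_rampClass hA hκ hn S hγ (k l) (hk l) (hδ l)
    exact ⟨T, h1.trans (hcard l), h2⟩

/-- The bound with logarithmic dependence on the numbers of parameters. -/
theorem rademacher_le_log_params (hA : A.Valid) (hκ : 2 ≤ A.dim A.L 0) {n : ℕ} (hn : 0 < n)
    (S : Fin n → Vec (A.dim 0 0) × Fin (A.dim A.L 0)) {γ : ℝ} (hγ : 0 < γ) :
    rademacher S (rampClass γ A.netClass) ≤
      4 / (n : ℝ) + 12 * (harmonic (n - 1) : ℝ) / √(n : ℝ) * √(Real.log (2 * (A.maxParams : ℝ))) *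
        (∑ i ∈ range A.L, ∑ j ∈ range (A.depth i),
          (⌈A.Ctilde γ (fun k => (S k).1) i j ^ (2 / 3 : ℝ)⌉₊ : ℝ)) ^ (3 / 2 : ℝ) := by
  set t : ℕ → ℕ → ℝ := fun i j => A.Ctilde γ (fun k => (S k).1) i j with ht
  have ht0 : ∀ i < A.L, ∀ j < A.depth i, 0 ≤ t i j := fun i hi j hj =>
    Ctilde_nonneg hA _ hγ hi hj
  set c : ℕ → ℕ → ℕ := fun i j => ⌈t i j ^ (2 / 3 : ℝ)⌉₊ with hc
  set D : ℕ := ∑ i ∈ range A.L, ∑ j ∈ range (A.depth i), c i j with hD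
  have hcD : ∀ i < A.L, ∀ j < A.depth i, c i j ≤ D := fun i hi j hj =>
    (single_le_sum (f := fun j => c i j) (fun _ _ => Nat.zero_le _) (mem_range.2 hj)).trans
      (single_le_sum (f := fun i => ∑ j ∈ range (A.depth i), c i j) (fun _ _ => Nat.zero_le _)
        (mem_range.2 hi))
  have hc0 : ∀ i < A.L, ∀ j < A.depth i, c i j = 0 → t i j = 0 := by
    intro i hi j hj h
    by_contra hne
    have hpos : 0 < t i j := lt_of_le_of_ne (ht0 i hi j hj) (Ne.symm hne)
    exact absurd (Nat.ceil_eq_zero.1 h) (not_le.2 (Real.rpow_pos_of_pos hpos _))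
  have htc : ∀ i < A.L, ∀ j < A.depth i, t i j ≤ c i j * √(c i j : ℝ) := by
    intro i hi j hj
    rw [← rpow_three_halves (Nat.cast_nonneg _)]
    calc t i j = (t i j ^ (2 / 3 : ℝ)) ^ (3 / 2 : ℝ) := by
          rw [← Real.rpow_mul (ht0 i hi j hj)]
          norm_num
      _ ≤ _ := Real.rpow_le_rpow (Real.rpow_nonneg (ht0 i hi j hj) _) (Nat.le_ceil _) (by norm_num)
  set W := Real.log (2 * (A.maxParams : ℝ)) with hW
  have hW0 : 0 ≤ W := by
    rw [hW]
    exact_mod_cast Real.log_natCast_nonneg (2 * A.maxParams)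
  have hDc : (∑ i ∈ range A.L, ∑ j ∈ range (A.depth i), (c i j : ℝ)) = D := by
    rw [hD]
    push_cast
    rfl
  change _ ≤ 4 / (n : ℝ) + 12 * (harmonic (n - 1) : ℝ) / √(n : ℝ) * √W *
    (∑ i ∈ range A.L, ∑ j ∈ range (A.depth i), (c i j : ℝ)) ^ (3 / 2 : ℝ)
  rw [hDc]
  clear_value c D
  -- Since `t_ij ≤ c_ij^(3/2)`, layer `(i, j)` uses at most the share `c_ij / D` of the radius
  -- `2^(-l)`, and the total sparsity is `D³ 4^l`.
  have main := rademacher_le_of_sparsities hA hκ hn S hγ (fun l i j => c i j * D ^ 2 * 4 ^ l)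
    (by
      intro l i hi j hj h
      apply hc0 i hi j hj
      by_contra hne
      have h1 : 0 < c i j := Nat.pos_of_ne_zero hne
      have h2 : 0 < D := h1.trans_le (hcD i hi j hj)
      have h3 : 0 < c i j * D ^ 2 * 4 ^ l := by positivity
      exact h3.ne' h)
    (by
      intro l
      have hterm : ∀ i < A.L, ∀ j < A.depth i,
          t i j / √((c i j * D ^ 2 * 4 ^ l : ℕ) : ℝ) ≤ (c i j : ℝ) / D * (1 / 2) ^ l := by
        intro i hi j hj
        by_cases h : c i j = 0
        · rw [hc0 i hi j hj h, zero_div]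
          positivity
        have hcpos : (0 : ℝ) < c i j := by exact_mod_cast Nat.pos_of_ne_zero h
        have hDpos : (0 : ℝ) < D := hcpos.trans_le (by exact_mod_cast hcD i hi j hj)
        have e : √((c i j * D ^ 2 * 4 ^ l : ℕ) : ℝ) = √(c i j : ℝ) * (D * 2 ^ l) := by
          rw [← Real.sqrt_sq (by positivity : (0 : ℝ) ≤ D * 2 ^ l), ← Real.sqrt_mul hcpos.le]
          congr 1
          push_cast
          rw [mul_pow, ← pow_mul, mul_comm l 2, pow_mul]
          norm_num
          ring
        rw [e, div_le_iff₀ (by positivity)]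
        refine (htc i hi j hj).trans (le_of_eq ?_)
        rw [one_div, inv_pow]
        field_simp
      calc _ ≤ ∑ i ∈ range A.L, ∑ j ∈ range (A.depth i), (c i j : ℝ) / D * (1 / 2) ^ l :=
            sum_le_sum fun i hi => sum_le_sum fun j hj =>
              hterm i (mem_range.1 hi) j (mem_range.1 hj)
        _ = ((D : ℝ) / D) * (1 / 2) ^ l := by
            simp only [← sum_mul, ← sum_div, hDc]
        _ ≤ (1 / 2) ^ l := mul_le_of_le_one_left (by positivity) (div_self_le_one _))
    (fun l => 4 ^ l * ((D : ℝ) ^ 3 * W))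
    (by
      intro l l' h
      have : (4 : ℝ) ^ l ≤ 4 ^ l' := pow_le_pow_right₀ (by norm_num) h
      exact mul_le_mul_of_nonneg_right this (by positivity))
    (by positivity)
    (by
      intro l
      calc _ ≤ ∑ i ∈ range A.L, ∑ j ∈ range (A.depth i), (c i j : ℝ) * (D ^ 2 * 4 ^ l * W) := by
            refine sum_le_sum fun i hi => sum_le_sum fun j hj => ?_
            refine (log_coverSize_le_mul_log_params _ _).trans
              ((mul_le_mul_of_nonneg_left (log_two_mul_numParams_le (mem_range.1 hi)
                (mem_range.1 hj)) (Nat.cast_nonneg _)).trans (le_of_eq ?_))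
            push_cast
            ring
        _ = (D : ℝ) * (D ^ 2 * 4 ^ l * W) := by
            simp only [← sum_mul, hDc]
        _ = _ := by ring)
    -- The chain stops near radius `√n / n`; each of its levels contributes the same amount, as
    -- `2^(-l)` cancels `√(4^l)`.
    (Nat.log 2 n)
  refine main.trans (add_le_add (half_pow_log_le hn) ?_)
  simp only [half_pow_mul_sqrt, sum_const, card_range, nsmul_eq_mul]
  have hsq : √((D : ℝ) ^ 3 * W) = √W * (D : ℝ) ^ (3 / 2 : ℝ) := by
    rw [rpow_three_halves (Nat.cast_nonneg _), Real.sqrt_mul (by positivity), pow_succ,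
      Real.sqrt_mul (by positivity), Real.sqrt_sq (Nat.cast_nonneg _)]
    ring
  rw [hsq]
  calc _ = 6 / √(n : ℝ) * (√W * (D : ℝ) ^ (3 / 2 : ℝ)) * (Nat.log 2 n : ℝ) := by ring
    _ ≤ 6 / √(n : ℝ) * (√W * (D : ℝ) ^ (3 / 2 : ℝ)) * (2 * (harmonic (n - 1) : ℝ)) :=
        mul_le_mul_of_nonneg_left (log_le_two_mul_harmonic hn) (by positivity)
    _ = _ := by ring

/-- The bound with linear dependence on the numbers of parameters. -/
theorem rademacher_le_params (hA : A.Valid) (hκ : 2 ≤ A.dim A.L 0) {n : ℕ} (hn : 0 < n)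
    (S : Fin n → Vec (A.dim 0 0) × Fin (A.dim A.L 0)) {γ : ℝ} (hγ : 0 < γ) :
    rademacher S (rampClass γ A.netClass) ≤
      12 / √(n : ℝ) * √(∑ i ∈ range A.L, ∑ j ∈ range (A.depth i), 2 * (A.numParams i j : ℝ) *
        (Real.log (1 +
            (⌈(A.totalLayers : ℝ) ^ 2 * A.Ctilde γ (fun k => (S k).1) i j ^ 2⌉₊ : ℝ)) +
          psi (⌈(A.totalLayers : ℝ) ^ 2 * A.Ctilde γ (fun k => (S k).1) i j ^ 2⌉₊ : ℝ))) := by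
  set t : ℕ → ℕ → ℝ := fun i j => A.Ctilde γ (fun k => (S k).1) i j with ht
  have ht0 : ∀ i < A.L, ∀ j < A.depth i, 0 ≤ t i j := fun i hi j hj =>
    Ctilde_nonneg hA _ hγ hi hj
  set a : ℕ → ℕ → ℕ := fun i j => ⌈(A.totalLayers : ℝ) ^ 2 * t i j ^ 2⌉₊ with ha
  change _ ≤ 12 / √(n : ℝ) * √(∑ i ∈ range A.L, ∑ j ∈ range (A.depth i),
    2 * (A.numParams i j : ℝ) * (Real.log (1 + a i j) + psi (a i j)))
  set Q := ∑ i ∈ range A.L, ∑ j ∈ range (A.depth i),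
    2 * (A.numParams i j : ℝ) * (Real.log (1 + a i j) + psi (a i j)) with hQ
  have hL : ∀ i < A.L, ∀ j < A.depth i, (0 : ℝ) < A.totalLayers := by
    intro i hi j hj
    have : A.depth i ≤ A.totalLayers :=
      single_le_sum (f := A.depth) (fun _ _ => Nat.zero_le _) (mem_range.2 hi)
    exact_mod_cast (by omega : 0 < A.totalLayers)
  have hlogmono : ∀ i j, Monotone fun l : ℕ => Real.log (1 + (a i j * 4 ^ l : ℕ)) := by
    intro i j l l' h
    refine Real.log_le_log (by positivity) ?_
    have : a i j * 4 ^ l ≤ a i j * 4 ^ l' :=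
      Nat.mul_le_mul_left _ (Nat.pow_le_pow_right (by norm_num) h)
    have : ((a i j * 4 ^ l : ℕ) : ℝ) ≤ (a i j * 4 ^ l' : ℕ) := by exact_mod_cast this
    linarith
  have hlog0 : ∀ i j l, 0 ≤ Real.log (1 + (a i j * 4 ^ l : ℕ)) := fun i j l => by
    refine Real.log_nonneg ?_
    have : (0 : ℝ) ≤ (a i j * 4 ^ l : ℕ) := Nat.cast_nonneg _
    linarith
  set Λ : ℕ → ℝ := fun l => ∑ i ∈ range A.L, ∑ j ∈ range (A.depth i),
    2 * (A.numParams i j : ℝ) * Real.log (1 + (a i j * 4 ^ l : ℕ)) with hΛ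
  have hΛ0 : ∀ l, 0 ≤ Λ l := fun l => sum_nonneg fun i _ => sum_nonneg fun j _ =>
    mul_nonneg (by positivity) (hlog0 i j l)
  -- Every layer gets the share `1 / totalLayers` of the radius `2^(-l)`.
  have main := rademacher_le_of_sparsities hA hκ hn S hγ (fun l i j => a i j * 4 ^ l)
    (by
      intro l i hi j hj h
      have h' : a i j = 0 := (Nat.mul_eq_zero.1 h).resolve_right (by positivity)
      have h2 := Nat.ceil_eq_zero.1 h'
      have hL' := hL i hi j hj
      by_contra hne
      have : t i j ≠ 0 := hne
      have : 0 < (A.totalLayers : ℝ) ^ 2 * t i j ^ 2 := by positivity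
      linarith)
    (by
      intro l
      have hterm : ∀ i < A.L, ∀ j < A.depth i,
          t i j / √((a i j * 4 ^ l : ℕ) : ℝ) ≤ 1 / A.totalLayers * (1 / 2) ^ l := by
        intro i hi j hj
        have hL' := hL i hi j hj
        have h1 : A.totalLayers * 2 ^ l * t i j ≤ √((a i j * 4 ^ l : ℕ) : ℝ) := by
          refine Real.le_sqrt_of_sq_le ?_
          push_cast
          have h2 : (A.totalLayers : ℝ) ^ 2 * t i j ^ 2 ≤ a i j := Nat.le_ceil _
          calc _ = ((A.totalLayers : ℝ) ^ 2 * t i j ^ 2) * 4 ^ l := by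
                rw [mul_pow, mul_pow, ← pow_mul, mul_comm l 2, pow_mul]
                norm_num
                ring
            _ ≤ _ := mul_le_mul_of_nonneg_right h2 (by positivity)
        refine div_le_of_le_mul₀ (Real.sqrt_nonneg _) (by positivity) ?_
        refine le_trans (le_of_eq ?_) (mul_le_mul_of_nonneg_left h1 (by positivity))
        rw [one_div_pow]
        field_simp
      calc _ ≤ ∑ i ∈ range A.L, ∑ j ∈ range (A.depth i),
              1 / (A.totalLayers : ℝ) * (1 / 2) ^ l :=
            sum_le_sum fun i hi => sum_le_sum fun j hj =>
              hterm i (mem_range.1 hi) j (mem_range.1 hj)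
        _ = (A.totalLayers : ℝ) / A.totalLayers * (1 / 2) ^ l := by
            simp only [sum_const, card_range, nsmul_eq_mul, ← sum_mul]
            rw [totalLayers]
            push_cast
            ring
        _ ≤ (1 / 2) ^ l := mul_le_of_le_one_left (by positivity) (div_self_le_one _))
    Λ
    (fun l l' h => sum_le_sum fun i _ => sum_le_sum fun j _ =>
      mul_le_mul_of_nonneg_left (hlogmono i j h) (by positivity))
    (hΛ0 0)
    (fun l => sum_le_sum fun i _ => sum_le_sum fun j _ => log_coverSize_le_mul_log_sparsity _ _)
  have hbound : ∀ N, ∑ j ∈ range N, (1 / 2 : ℝ) ^ (j + 1) * √(Λ (j + 1)) ≤ 2 * √Q := by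
    intro N
    refine (sum_half_pow_mul_sqrt_le (fun j => Λ (j + 1)) (fun j => hΛ0 _) N).trans ?_
    rw [show (2 : ℝ) * √Q = √(4 * Q) by
      rw [Real.sqrt_mul (by norm_num), show (4 : ℝ) = 2 ^ 2 by norm_num,
        Real.sqrt_sq (by norm_num)]]
    refine Real.sqrt_le_sqrt ?_
    simp only [hΛ, hQ, mul_sum]
    rw [sum_comm]
    refine sum_le_sum fun i _ => ?_
    rw [sum_comm]
    refine sum_le_sum fun j _ => ?_
    calc _ = 2 * (A.numParams i j : ℝ) * ∑ l ∈ range N,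
          (1 / 2 : ℝ) ^ (l + 1) * Real.log (1 + (a i j * 4 ^ (l + 1) : ℕ)) := by
          rw [mul_sum]
          exact sum_congr rfl fun l _ => by ring
      _ ≤ 2 * (A.numParams i j : ℝ) * (4 * (Real.log (1 + a i j) + psi (a i j))) :=
          mul_le_mul_of_nonneg_left (sum_half_pow_mul_log_le _ _) (by positivity)
      _ = _ := by ring
  have hN : ∀ N : ℕ, rademacher S (rampClass γ A.netClass) ≤
      (1 / 2) ^ N + 12 / √(n : ℝ) * √Q := by
    intro N
    refine (main N).trans (add_le_add le_rfl ?_)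
    refine (mul_le_mul_of_nonneg_left (hbound N) (by positivity)).trans (le_of_eq ?_)
    ring
  -- The entropy sums are bounded uniformly in `N`, so the truncation term can be sent to zero.
  refine ge_of_tendsto' (x := Filter.atTop) ?_ hN
  simpa using (tendsto_pow_atTop_nhds_zero_of_lt_one (r := (1 / 2 : ℝ)) (by norm_num)
    (by norm_num)).add_const (12 / √(n : ℝ) * √Q)

end Architecture

end ResNet

theorem mainTheorem1 :
    (∀ (A : ResNet.Architecture) (_hA : A.Valid) (_hκ : 2 ≤ A.dim A.L 0)
      (n : ℕ) (_hn : 0 < n)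
      (S : Fin n → ResNet.Vec (A.dim 0 0) × Fin (A.dim A.L 0)) (γ : ℝ) (_hγ : 0 < γ),
      ResNet.rademacher S (ResNet.rampClass γ A.netClass) ≤
          4 / (n : ℝ) + 12 * (harmonic (n - 1) : ℝ) / √(n : ℝ) *
            √(Real.log (2 * (A.maxParams : ℝ))) *
            (∑ i ∈ Finset.range A.L, ∑ j ∈ Finset.range (A.depth i),
              (⌈A.Ctilde γ (fun k => (S k).1) i j ^ (2 / 3 : ℝ)⌉₊ : ℝ)) ^ (3 / 2 : ℝ) ∧
      ResNet.rademacher S (ResNet.rampClass γ A.netClass) ≤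
          12 / √(n : ℝ) *
            √(∑ i ∈ Finset.range A.L, ∑ j ∈ Finset.range (A.depth i),
              2 * (A.numParams i j : ℝ) *
                (Real.log (1 +
                    (⌈(A.totalLayers : ℝ) ^ 2 * A.Ctilde γ (fun k => (S k).1) i j ^ 2⌉₊ : ℝ)) +
                  ResNet.psi
                    (⌈(A.totalLayers : ℝ) ^ 2 * A.Ctilde γ (fun k => (S k).1) i j ^ 2⌉₊ : ℝ)))) ∧
    StrictMonoOn ResNet.psi (Set.Ici 0) ∧ ResNet.psi 0 = 0 ∧
    (∀ x : ℝ, 0 ≤ x → ResNet.psi x < 2.7) ∧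
    (fun n : ℕ => (harmonic (n - 1) : ℝ)) =O[Filter.atTop] (fun n : ℕ => Real.log (n : ℝ)) := by
  exact ⟨fun A hA hκ n hn S γ hγ =>
      ⟨ResNet.Architecture.rademacher_le_log_params hA hκ hn S hγ,
        ResNet.Architecture.rademacher_le_params hA hκ hn S hγ⟩,
    ResNet.strictMonoOn_psi, ResNet.psi_zero, fun _ hx => ResNet.psi_lt hx,
    ResNet.harmonic_isBigO_log⟩
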